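/- **Theorem B.1.** Let $c>0$ and $C,K\in\mathbb R$. There is $\varepsilon>0$, depending only on $c,C,K$, such that the following holds for all $n\ge1$ and all $\zeta,\rho\in(0,\varepsilon]$. *Setup.* Let $M=(m_{jk})$ be an invertible real $n\times n$ matrix such that the diagonal entries of $M$ and of $M^{-1}$ lie in $[c,C]$ and the off-diagonal entries of both have absolute value at most $K/n$. Let $\boldsymbol f_1,\dots,\boldsymbol f_n$ be the columns of $M$, $\mathcal L=\{\sum_j k_j\boldsymbol f_j: k_j\in\mathbb Z\}$ and $B=\{\sum_j t_j\boldsymbol f_j: t_j\in(-\frac12,\frac12]\}$. For $\boldsymbol x\in\mathbb R^n$ let $\tau_B(\boldsymbol x)$ be the unique point of $B$ with $\boldsymbol x-\tau_B(\boldsymbol x)\in\mathcal L$, and put $\tau_B(S)=\{\tau_B(\boldsymbol x):\boldsymbol x\in S\}$. Let $U_n(t)=\{\boldsymbol x\in\mathbb R^n: |x_j|\le t \text{ for all } j\}$ and, for $J\subseteq[n]=\{1,\dots,n\}$, let $U_J(t)=\{\boldsymbol x\in U_n(t): x_j=0\text{ for } j\in J\}$. Let $\|M\|_\infty=\max_j\sum_k|m_{jk}|$,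 and let $\boldsymbol e_1,\dots,\boldsymbol e_n$ be the standard basis of $\mathbb R^n$. *Hypotheses.* Let $H:\mathbb R^n\to\mathbb C$ be $\mathcal L$-periodic and absolutely integrable on $B$. Let $B_{\mathrm{abs}}$ satisfy $$\Bigl\{\boldsymbol x\in B:\ \sum_{j=1}^n|x_j|\,\mathbf 1_{|x_j|>\rho/3}>\tfrac13\zeta n\rho\Bigr\}\subseteq B_{\mathrm{abs}}\subseteq B,$$ and let $B_{\mathrm{abs}}\cap S$ be Lebesgue measurable within $S$ for every affine subspace $S$ of $\mathbb R^n$. Suppose that $L:[n]\to[0,\infty)$ satisfies $$\Bigl|\int_W H(\boldsymbol w+\boldsymbol y)\,d\boldsymbol y\Bigr|\le L(|J|)$$ (an integral with respect to $(n-|J|)$-dimensional Lebesgue measure; for $|J|=n$ it is $H(\boldsymbol w)$) for every non-empty $J\subseteq[n]$, every closed axis-aligned cuboid $W$ with $U_J(\frac13\rho)\subseteq W\subseteq U_J(\frac43\rho)$, and every $\boldsymbol w\in(B+U_n(\frac13\rho))\cap\operatorname{span}\{\boldsymbol e_j:j\in J\}$, whenever this integral converges absolutely and 1. $|w_j|>\dfrac{\rho\,m_{jj}}{9\max_{i\in[n]}m_{ii}}$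 for all $j\in J$, and 2. $\tau_B(\boldsymbol w+U_J(2\rho))\cap(B\setminus B_{\mathrm{abs}})\ne\emptyset$. *Conclusion.* $$\Bigl|\int_{B\setminus U_n(\rho)}H(\boldsymbol x)\,d\boldsymbol x\Bigr|\le\int_{B_{\mathrm{abs}}}|H(\boldsymbol x)|\,d\boldsymbol x+\sum_{j=1}^n\bigl(n\|M\|_\infty\bigr)^jL(j).$$ -/

import Mathlib

open MeasureTheory
open scoped Pointwise Matrix

namespace PeriodicBoxing

/-- Bounds on `M` and `M⁻¹`: `M` is invertible, the diagonal entries of both matrices lie in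
`[c, C]`, and the off-diagonal entries of both matrices are at most `K / n` in absolute value. -/
structure NearDiagonal (c C K : ℝ) {n : ℕ} (M : Matrix (Fin n) (Fin n) ℝ) : Prop where
  isUnit_det : IsUnit M.det
  diag : ∀ j, c ≤ M j j ∧ M j j ≤ C
  diag_inv : ∀ j, c ≤ M⁻¹ j j ∧ M⁻¹ j j ≤ C
  off_diag : ∀ i j, i ≠ j → |M i j| ≤ K / n
  off_diag_inv : ∀ i j, i ≠ j → |M⁻¹ i j| ≤ K / n

/-- The matrix norm induced by the vector sup norm (the maximal absolute row sum). -/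
noncomputable def inftyNorm {n : ℕ} (M : Matrix (Fin n) (Fin n) ℝ) : ℝ :=
  @norm _ Matrix.linftyOpNormedAddCommGroup.toNorm M

/-- The lattice of integer combinations of the columns of `M`. -/
def lattice {n : ℕ} (M : Matrix (Fin n) (Fin n) ℝ) : Set (Fin n → ℝ) :=
  {x | ∃ k : Fin n → ℤ, x = M *ᵥ (fun j => (k j : ℝ))}

/-- The half-open parallelepiped, centred at the origin, spanned by the columns of `M`. -/
def cell {n : ℕ} (M : Matrix (Fin n) (Fin n) ℝ) : Set (Fin n → ℝ) :=
  {x | ∃ t : Fin n → ℝ, (∀ j, t j ∈ Set.Ioc (-(1 / 2) : ℝ) (1 / 2)) ∧ x = M *ᵥ t}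

/-- Every point has a unique representative in the cell modulo the lattice. -/
theorem existsUnique_mem_cell {n : ℕ} {M : Matrix (Fin n) (Fin n) ℝ} (hM : IsUnit M.det)
    (x : Fin n → ℝ) : ∃! y, y ∈ cell M ∧ x - y ∈ lattice M := by
  have hx : M *ᵥ (M⁻¹ *ᵥ x) = x := by
    rw [Matrix.mulVec_mulVec, Matrix.mul_nonsing_inv M hM, Matrix.one_mulVec]
  set s := M⁻¹ *ᵥ x with hs
  refine ⟨M *ᵥ (fun j => s j - (⌈s j - 1 / 2⌉ : ℤ)), ⟨⟨_, fun j => ?_, rfl⟩,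
    fun j => ⌈s j - 1 / 2⌉, ?_⟩, ?_⟩
  · have h1 := Int.le_ceil (s j - 1 / 2)
    have h2 := Int.ceil_lt_add_one (s j - 1 / 2)
    constructor <;> linarith
  · rw [← hx, ← Matrix.mulVec_sub]
    congr 1
    funext j
    simp
  · rintro y ⟨⟨t, ht, rfl⟩, k, hk⟩
    have hinj : Function.Injective (fun v => M *ᵥ v) :=
      Matrix.mulVec_injective_iff_isUnit.2 ((Matrix.isUnit_iff_isUnit_det M).2 hM)
    rw [← hx, ← Matrix.mulVec_sub] at hk
    have hk' := hinj hk
    congr 1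
    funext j
    have hj : s j - t j = k j := congrFun hk' j
    have : ⌈s j - 1 / 2⌉ = k j := by
      rw [Int.ceil_eq_iff]
      obtain ⟨h1, h2⟩ := ht j
      constructor <;> linarith
    rw [this]
    linarith

/-- The reduction of a set modulo the lattice: the set of the representatives in the cell
of the points of `S`. -/
def reduceSet {n : ℕ} (M : Matrix (Fin n) (Fin n) ℝ) (S : Set (Fin n → ℝ)) :
    Set (Fin n → ℝ) :=
  {y | y ∈ cell M ∧ ∃ x ∈ S, x - y ∈ lattice M}

/-- The cube `[-t, t]ⁿ`. -/
def cube (n : ℕ) (t : ℝ) : Set (Fin n → ℝ) :=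
  {x | ∀ j, |x j| ≤ t}

/-- The points of the cube `[-t, t]ⁿ` whose coordinates in `J` vanish. -/
def cubeSlice {n : ℕ} (J : Finset (Fin n)) (t : ℝ) : Set (Fin n → ℝ) :=
  {x | x ∈ cube n t ∧ ∀ j ∈ J, x j = 0}

/-- Extension by zero of a vector indexed by the complement of `J`. -/
def extendZero {n : ℕ} (J : Finset (Fin n)) (y : {j : Fin n // j ∉ J} → ℝ) : Fin n → ℝ :=
  fun j => if h : j ∉ J then y ⟨j, h⟩ else 0

/-- The integral of `y ↦ H (w + y)` over a subset `W` of the coordinate subspace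
`{y | ∀ j ∈ J, y j = 0}`, with respect to Lebesgue measure of dimension `n - |J|`. -/
noncomputable def sliceIntegral {n : ℕ} (J : Finset (Fin n)) (W : Set (Fin n → ℝ))
    (H : (Fin n → ℝ) → ℂ) (w : Fin n → ℝ) : ℂ :=
  ∫ y in extendZero J ⁻¹' W, H (w + extendZero J y)

/-- The trace of `S` on every affine subspace is Lebesgue measurable in that subspace
(nonempty affine subspaces are given by injective affine parametrizations). -/
def AffinelyMeasurable {n : ℕ} (S : Set (Fin n → ℝ)) : Prop :=
  ∀ (k : ℕ) (φ : (Fin k → ℝ) →ᵃ[ℝ] (Fin n → ℝ)), Function.Injective φ →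
    NullMeasurableSet (φ ⁻¹' S) (volume : Measure (Fin k → ℝ))

/-- The points of the cell at which the coordinates exceeding `ρ / 3` in absolute value have
absolute sum larger than `ζ n ρ / 3`. -/
def largeRegion {n : ℕ} (M : Matrix (Fin n) (Fin n) ℝ) (ζ ρ : ℝ) : Set (Fin n → ℝ) :=
  {x | x ∈ cell M ∧ (1 / 3) * ζ * n * ρ < ∑ j, if ρ / 3 < |x j| then |x j| else 0}

end PeriodicBoxing

/-! Since `H` is periodic, the cell may be replaced by any other fundamental domain. If `|J| κ ≤ c /
12`, the `J × J` block of `M` is invertible, so every point has a unique projection along the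
columns in `J` that vanishes on `J`; the tube of `J` consists of the points whose projection lies in
a cube of half-width close to `ρ`. The half-widths shrink with `|J|` just fast enough that two tubes
meet inside the tube of `J ∩ J'` (`mem_tube_inter`), and this persists modulo the lattice. Removing
from each tube those of the proper subsets, and reducing the coordinates along the columns, leaves
pieces that are disjoint modulo the lattice (`eq_of_mem_piece`); the piece of `∅` is the excluded
cube. A point of the cell outside `Babs` has few large coordinates and lies in the tube of those
(`mem_tube_large`), so the pieces miss only points of `Babs`.

The piece of `J` fibres into axis-parallel boxes in the directions off `J` (`add_mem_piece`). The
hypothesis bounds the integral over such a box unless the box lies in the periodised `Babs`, where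
`‖H‖` is charged instead. The boxes are parametrised by a set inside a cube of volume `inftyNorm M ^
|J|`, and there are at most `n ^ j` sets `J` of size `j`. -/

namespace PeriodicBoxing

/-! ### Projections along a few columns of a nearly diagonal matrix -/

/-- Entrywise lower bound on the diagonal and upper bounds off the diagonal of `M`, together with a
sup-norm bound for `M⁻¹`. -/
structure Dominant (c κ q : ℝ) {n : ℕ} (M : Matrix (Fin n) (Fin n) ℝ) : Prop where
  c_pos : 0 < c
  κ_nonneg : 0 ≤ κ
  q_nonneg : 0 ≤ q
  isUnit_det : IsUnit M.det
  diag : ∀ j, c ≤ M j j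
  off_diag : ∀ i j, i ≠ j → |M i j| ≤ κ
  inv_bound : ∀ (x : Fin n → ℝ) (r : ℝ), (∀ j, |x j| ≤ r) → ∀ i, |(M⁻¹ *ᵥ x) i| ≤ q * r

/-- The vectors supported on `J`. -/
def SuppOn {n : ℕ} (J : Finset (Fin n)) (u : Fin n → ℝ) : Prop := ∀ i, i ∉ J → u i = 0

/-- The real vector with the given integer coordinates. -/
def intVec {n : ℕ} (k : Fin n → ℤ) : Fin n → ℝ := fun j => (k j : ℝ)

variable {n : ℕ} {M : Matrix (Fin n) (Fin n) ℝ} {c κ q ρ : ℝ} {I J : Finset (Fin n)}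

@[simp] lemma intVec_apply (k : Fin n → ℤ) (j : Fin n) : intVec k j = k j := rfl

lemma intVec_add (k l : Fin n → ℤ) : intVec (k + l) = intVec k + intVec l := by
  funext j; simp

lemma intVec_neg (k : Fin n → ℤ) : intVec (-k) = -intVec k := by
  funext j; simp

@[simp] lemma intVec_zero : intVec (0 : Fin n → ℤ) = 0 := by
  funext j; simp

lemma SuppOn.mono {u : Fin n → ℝ} (hu : SuppOn I u) (h : I ⊆ J) : SuppOn J u :=
  fun i hi => hu i fun hi' => hi (h hi')

lemma SuppOn.add {u v : Fin n → ℝ} (hu : SuppOn J u) (hv : SuppOn J v) : SuppOn J (u + v) :=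
  fun i hi => by simp [hu i hi, hv i hi]

lemma SuppOn.sub {u v : Fin n → ℝ} (hu : SuppOn J u) (hv : SuppOn J v) : SuppOn J (u - v) :=
  fun i hi => by simp [hu i hi, hv i hi]

lemma mem_cubeSlice {t : ℝ} {x : Fin n → ℝ} :
    x ∈ cubeSlice J t ↔ (∀ j, |x j| ≤ t) ∧ ∀ j ∈ J, x j = 0 := Iff.rfl

lemma mem_cubeSlice_of {t : ℝ} (ht : 0 ≤ t) {x : Fin n → ℝ} (h0 : ∀ j ∈ J, x j = 0)
    (h : ∀ j, j ∉ J → |x j| ≤ t) : x ∈ cubeSlice J t := by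
  refine ⟨fun j => ?_, h0⟩
  by_cases hj : j ∈ J
  · simpa [h0 j hj] using ht
  · exact h j hj

namespace Dominant

variable (hM : Dominant c κ q M)
include hM

lemma abs_mulVec_le {r : Fin n → ℝ} (hr : SuppOn J r) {i : Fin n} (hi : i ∉ J) :
    |(M *ᵥ r) i| ≤ κ * ∑ j ∈ J, |r j| := by
  have h : (M *ᵥ r) i = ∑ j ∈ J, M i j * r j := by
    simp only [Matrix.mulVec, dotProduct]
    symm
    exact Finset.sum_subset (Finset.subset_univ _) fun j _ hj => by simp [hr j hj]
  rw [h, Finset.mul_sum]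
  refine (Finset.abs_sum_le_sum_abs _ _).trans (Finset.sum_le_sum fun j hj => ?_)
  rw [abs_mul]
  exact mul_le_mul_of_nonneg_right (hM.off_diag i j (by rintro rfl; exact hi hj)) (abs_nonneg _)

lemma diag_mul_abs_le {r : Fin n → ℝ} (hr : SuppOn J r) {i : Fin n} (hi : i ∈ J) :
    c * |r i| ≤ |(M *ᵥ r) i| + κ * ∑ j ∈ J, |r j| := by
  have h : (M *ᵥ r) i = M i i * r i + ∑ j ∈ J.erase i, M i j * r j := by
    rw [Finset.add_sum_erase _ (fun j => M i j * r j) hi]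
    simp only [Matrix.mulVec, dotProduct]
    symm
    exact Finset.sum_subset (Finset.subset_univ _) fun j _ hj => by simp [hr j hj]
  have h2 : |∑ j ∈ J.erase i, M i j * r j| ≤ κ * ∑ j ∈ J, |r j| := by
    rw [Finset.mul_sum]
    refine (Finset.abs_sum_le_sum_abs _ _).trans ?_
    refine (Finset.sum_le_sum fun j hj => ?_).trans
      (Finset.sum_le_sum_of_subset_of_nonneg (Finset.erase_subset i J) fun j _ _ =>
        mul_nonneg hM.κ_nonneg (abs_nonneg (r j)))
    rw [abs_mul]
    exact mul_le_mul_of_nonneg_right (hM.off_diag i j (Finset.ne_of_mem_erase hj).symm)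
      (abs_nonneg _)
  have h3 : c * |r i| ≤ |M i i * r i| := by
    rw [abs_mul]
    exact mul_le_mul_of_nonneg_right ((hM.diag i).trans (le_abs_self _)) (abs_nonneg _)
  have h4 : M i i * r i = (M *ᵥ r) i - ∑ j ∈ J.erase i, M i j * r j := by rw [h]; ring
  have h5 := abs_sub ((M *ᵥ r) i) (∑ j ∈ J.erase i, M i j * r j)
  rw [← h4] at h5
  linarith

/-- Summing the dominance inequality over `J` gives an off-diagonal error of at most `|J| κ ≤ c /
12` times the left side, which is absorbed. -/
lemma sum_abs_le (hJ : J.card * κ ≤ c / 12) {r : Fin n → ℝ} (hr : SuppOn J r) :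
    ∑ j ∈ J, |r j| ≤ 2 / c * ∑ j ∈ J, |(M *ᵥ r) j| := by
  have h := Finset.sum_le_sum fun i (hi : i ∈ J) => hM.diag_mul_abs_le hr hi
  rw [← Finset.mul_sum, Finset.sum_add_distrib, Finset.sum_const, nsmul_eq_mul] at h
  have h0 : 0 ≤ ∑ j ∈ J, |r j| := Finset.sum_nonneg fun _ _ => abs_nonneg _
  have h1 : (J.card : ℝ) * (κ * ∑ j ∈ J, |r j|) ≤ c / 12 * ∑ j ∈ J, |r j| := by
    rw [← mul_assoc]; exact mul_le_mul_of_nonneg_right hJ h0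
  have hc := hM.c_pos
  rw [div_mul_eq_mul_div, le_div_iff₀ hc]
  nlinarith

lemma eq_of_lift (hJ : J.card * κ ≤ c / 12) {u v : Fin n → ℝ} (hu : SuppOn J u) (hv : SuppOn J v)
    (h : ∀ j ∈ J, (M *ᵥ u) j = (M *ᵥ v) j) : u = v := by
  have h1 := hM.sum_abs_le hJ (hu.sub hv)
  have h2 : ∑ j ∈ J, |(M *ᵥ (u - v)) j| = 0 := Finset.sum_eq_zero fun j hj => by
    simp [Matrix.mulVec_sub, h j hj]
  rw [h2, mul_zero] at h1
  have h3 := (Finset.sum_eq_zero_iff_of_nonneg fun j _ => abs_nonneg ((u - v) j)).1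
    (le_antisymm h1 (Finset.sum_nonneg fun _ _ => abs_nonneg _))
  funext j
  by_cases hj : j ∈ J
  · have := h3 j hj
    simpa [sub_eq_zero] using this
  · rw [hu j hj, hv j hj]

/-- The `J × J` block, extended by the identity off `J`, is injective by `eq_of_lift`, hence
invertible. Linearity of the lift is what later makes tubes and pieces measurable. -/
lemma exists_linear_lift (hJ : J.card * κ ≤ c / 12) :
    ∃ U : (Fin n → ℝ) →ₗ[ℝ] (Fin n → ℝ), (∀ x, SuppOn J (U x)) ∧
      ∀ x, ∀ j ∈ J, (M *ᵥ U x) j = x j := by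
  classical
  let R : (Fin n → ℝ) →ₗ[ℝ] (Fin n → ℝ) :=
    LinearMap.pi fun i => if i ∈ J then LinearMap.proj i else 0
  have hR : ∀ x i, R x i = if i ∈ J then x i else 0 := fun x i => by
    by_cases hi : i ∈ J <;> simp [R, hi]
  let A : (Fin n → ℝ) →ₗ[ℝ] (Fin n → ℝ) :=
    R ∘ₗ M.mulVecLin ∘ₗ R + (LinearMap.id - R)
  have hA : ∀ x i, A x i = if i ∈ J then (M *ᵥ R x) i else x i := fun x i => by
    by_cases hi : i ∈ J <;> simp [A, hR, hi]
  have hsupp : ∀ x, SuppOn J (R x) := fun x i hi => by simp [hR, hi]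
  have hinj : Function.Injective A := by
    intro x y hxy
    have h1 : R x = R y := hM.eq_of_lift hJ (hsupp x) (hsupp y) fun j hj => by
      have := congrFun hxy j
      simpa [hA, hj] using this
    funext i
    by_cases hi : i ∈ J
    · have := congrFun h1 i
      simpa [hR, hi] using this
    · have := congrFun hxy i
      simpa [hA, hi] using this
  let e := LinearEquiv.ofInjectiveEndo A hinj
  refine ⟨R ∘ₗ e.symm.toLinearMap, fun x => hsupp _, fun x j hj => ?_⟩
  have h1 : A (e.symm x) = x := e.apply_symm_apply x
  have h2 := congrFun h1 j
  rw [hA, if_pos hj] at h2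
  exact h2

lemma exists_lift (hJ : J.card * κ ≤ c / 12) (x : Fin n → ℝ) :
    ∃ u, SuppOn J u ∧ ∀ j ∈ J, (x - M *ᵥ u) j = 0 := by
  obtain ⟨U, h1, h2⟩ := hM.exists_linear_lift hJ
  exact ⟨U x, h1 x, fun j hj => by simp [h2 x j hj]⟩

/-- Projections along the columns in `I` and in a larger set `J` differ, off `J`, by little. -/
lemma abs_sub_le_of_lift (hIJ : I ⊆ J) (hJ : J.card * κ ≤ c / 12) {x u v : Fin n → ℝ}
    (hu : SuppOn I u) (hv : SuppOn J v) (hu0 : ∀ j ∈ I, (x - M *ᵥ u) j = 0)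
    (hv0 : ∀ j ∈ J, (x - M *ᵥ v) j = 0) {i : Fin n} (hi : i ∉ J) :
    |(x - M *ᵥ u) i - (x - M *ᵥ v) i| ≤ 2 * κ / c * ∑ j ∈ J \ I, |(x - M *ᵥ u) j| := by
  have hr : SuppOn J (v - u) := hv.sub (hu.mono hIJ)
  have h1 := hM.abs_mulVec_le hr hi
  have h2 := hM.sum_abs_le hJ hr
  -- On `J` the projection `x - M v` vanishes, so `M (v - u)` agrees there with `x - M u`, which
  -- itself vanishes on `I`.
  have h3 : ∑ j ∈ J, |(M *ᵥ (v - u)) j| = ∑ j ∈ J \ I, |(x - M *ᵥ u) j| := by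
    have h4 : ∀ j ∈ J, |(M *ᵥ (v - u)) j| = |(x - M *ᵥ u) j| := fun j hj => by
      have := hv0 j hj
      simp only [Pi.sub_apply] at this
      simp only [Matrix.mulVec_sub, Pi.sub_apply]
      congr 1
      linarith
    rw [Finset.sum_congr rfl h4, ← Finset.sum_sdiff hIJ, Finset.sum_eq_zero (s := I), add_zero]
    exact fun j hj => by rw [hu0 j hj, abs_zero]
  rw [h3] at h2
  have h5 : (x - M *ᵥ u) i - (x - M *ᵥ v) i = (M *ᵥ (v - u)) i := by
    simp [Matrix.mulVec_sub]
  rw [h5]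
  calc _ ≤ _ := h1
    _ ≤ κ * (2 / c * ∑ j ∈ J \ I, |(x - M *ᵥ u) j|) := mul_le_mul_of_nonneg_left h2 hM.κ_nonneg
    _ = _ := by ring

end Dominant

/-! ### Tubes and their intersections -/

/-- The half-width of the tubes attached to `J`. -/
noncomputable def radius (c κ ρ : ℝ) (J : Finset (Fin n)) : ℝ := ρ * (1 - J.card * (4 * κ / c))

/-- The points that can be moved by a combination of the columns in `J` to the slice of a cube. -/
def tube (M : Matrix (Fin n) (Fin n) ℝ) (J : Finset (Fin n)) (r : ℝ) : Set (Fin n → ℝ) :=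
  {x | ∃ u, SuppOn J u ∧ x - M *ᵥ u ∈ cubeSlice J r}

lemma tube_add_mulVec {r : ℝ} {x v : Fin n → ℝ} (hx : x ∈ tube M J r) (hv : SuppOn J v) :
    x + M *ᵥ v ∈ tube M J r := by
  obtain ⟨u, hu, h⟩ := hx
  refine ⟨u + v, hu.add hv, ?_⟩
  rwa [Matrix.mulVec_add, add_sub_add_right_eq_sub]

namespace Dominant

variable (hM : Dominant c κ q M) (hρ : 0 < ρ)
include hM hρ

lemma radius_le : radius c κ ρ J ≤ ρ := by
  have h : 0 ≤ (J.card : ℝ) * (4 * κ / c) :=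
    mul_nonneg (Nat.cast_nonneg _) (div_nonneg (mul_nonneg (by norm_num) hM.κ_nonneg) hM.c_pos.le)
  unfold radius
  nlinarith

lemma le_radius (hJ : J.card * κ ≤ c / 12) : 2 / 3 * ρ ≤ radius c κ ρ J := by
  have hc := hM.c_pos
  have h : (J.card : ℝ) * (4 * κ / c) ≤ 1 / 3 := by
    rw [mul_div_assoc', div_le_iff₀ hc]; linarith
  unfold radius
  nlinarith

-- The gap between the radii is exactly the error in `abs_sub_le_of_lift` when the coordinates in `J
-- \ I` are at most `2ρ`; this dictates the rate `4κ/c`.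
omit hM hρ in
lemma radius_sub (hIJ : I ⊆ J) :
    radius c κ ρ I = radius c κ ρ J + 2 * κ / c * ((J \ I).card * (2 * ρ)) := by
  have h : ((J \ I).card : ℝ) = J.card - I.card := by
    rw [Finset.card_sdiff_of_subset hIJ, Nat.cast_sub (Finset.card_le_card hIJ)]
  unfold radius
  rw [h]
  ring

omit hM hρ in
lemma card_mul_le_of_subset (hM : Dominant c κ q M) (hIJ : I ⊆ J) (hJ : J.card * κ ≤ c / 12) :
    I.card * κ ≤ c / 12 :=
  (mul_le_mul_of_nonneg_right (Nat.cast_le.2 (Finset.card_le_card hIJ)) hM.κ_nonneg).trans hJ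

omit hρ in
/-- Off `J`, projecting along fewer columns keeps a point of the tube of `J` within the wider tube
of `I`. -/
lemma abs_le_radius_of_lift (hIJ : I ⊆ J) (hJ : J.card * κ ≤ c / 12) {x u : Fin n → ℝ}
    (hx : x ∈ tube M J (radius c κ ρ J)) (hu : SuppOn I u) (hu0 : ∀ j ∈ I, (x - M *ᵥ u) j = 0)
    (hb : ∀ j ∈ J \ I, |(x - M *ᵥ u) j| ≤ 2 * ρ) {i : Fin n} (hi : i ∉ J) :
    |(x - M *ᵥ u) i| ≤ radius c κ ρ I := by
  obtain ⟨v, hv, hv1, hv0⟩ := hx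
  have h1 := hM.abs_sub_le_of_lift hIJ hJ hu hv hu0 hv0 hi
  have h2 : ∑ j ∈ J \ I, |(x - M *ᵥ u) j| ≤ (J \ I).card * (2 * ρ) := by
    have := Finset.sum_le_card_nsmul _ _ _ hb
    rwa [nsmul_eq_mul] at this
  have h3 := mul_le_mul_of_nonneg_left h2
    (div_nonneg (mul_nonneg (by norm_num : (0 : ℝ) ≤ 2) hM.κ_nonneg) hM.c_pos.le)
  rw [radius_sub hIJ]
  have h4 := abs_sub_abs_le_abs_sub ((x - M *ᵥ u) i) ((x - M *ᵥ v) i)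
  have h5 := hv1 i
  linarith

/-- Project along `J ∩ J'` only. Each index outside `J ∩ J'` is outside `J` or `J'`, so comparison
with that projection first gives a crude bound `2ρ` on all coordinates, and then, with this bound as
input, the sharp radius. -/
lemma mem_tube_inter {J' : Finset (Fin n)} (hJ : J.card * κ ≤ c / 12)
    (hJ' : J'.card * κ ≤ c / 12) {x : Fin n → ℝ} (hx : x ∈ tube M J (radius c κ ρ J))
    (hx' : x ∈ tube M J' (radius c κ ρ J')) :
    x ∈ tube M (J ∩ J') (radius c κ ρ (J ∩ J')) := by
  have hI := card_mul_le_of_subset hM (Finset.inter_subset_left (s₁ := J) (s₂ := J')) hJ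
  obtain ⟨u, hu, hu0⟩ := hM.exists_lift hI x
  have hr0 : 0 ≤ radius c κ ρ (J ∩ J') := by linarith [hM.le_radius hρ hI]
  set z := x - M *ᵥ u with hz
  have key : ∀ A : Finset (Fin n), J ∩ J' ⊆ A → A.card * κ ≤ c / 12 →
      x ∈ tube M A (radius c κ ρ A) → ∀ i, i ∉ A → |z i| ≤ ρ + 1 / 2 * ‖z‖ := by
    rintro A hA hAc ⟨v, hv, hv1, hv0⟩ i hi
    have h1 := hM.abs_sub_le_of_lift hA hAc hu hv hu0 hv0 hi
    have h2 : ∑ j ∈ A \ (J ∩ J'), |z j| ≤ A.card * ‖z‖ := by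
      have := Finset.sum_le_card_nsmul (A \ (J ∩ J')) (fun j => |z j|) ‖z‖
        fun j _ => norm_le_pi_norm z j
      rw [nsmul_eq_mul] at this
      refine this.trans (mul_le_mul_of_nonneg_right ?_ (norm_nonneg _))
      exact_mod_cast Finset.card_le_card Finset.sdiff_subset
    have h3 := mul_le_mul_of_nonneg_left h2
      (div_nonneg (mul_nonneg (by norm_num : (0 : ℝ) ≤ 2) hM.κ_nonneg) hM.c_pos.le)
    have h4 := abs_sub_abs_le_abs_sub (z i) ((x - M *ᵥ v) i)
    have h5 := (hv1 i).trans (hM.radius_le hρ)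
    have h6 : 2 * κ / c * (A.card * ‖z‖) ≤ 1 / 2 * ‖z‖ := by
      rw [← mul_assoc]
      refine mul_le_mul_of_nonneg_right ?_ (norm_nonneg _)
      rw [div_mul_eq_mul_div, div_le_iff₀ hM.c_pos]
      linarith [hM.c_pos]
    linarith
  have hnorm : ‖z‖ ≤ 2 * ρ := by
    have : ‖z‖ ≤ ρ + 1 / 2 * ‖z‖ := by
      refine (pi_norm_le_iff_of_nonneg (by positivity)).2 fun i => ?_
      by_cases hi : i ∈ J
      · by_cases hi' : i ∈ J'
        · rw [hu0 i (Finset.mem_inter.2 ⟨hi, hi'⟩), norm_zero]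
          positivity
        · exact key J' Finset.inter_subset_right hJ' hx' i hi'
      · exact key J Finset.inter_subset_left hJ hx i hi
    linarith
  refine ⟨u, hu, mem_cubeSlice_of hr0 hu0 fun i hi => ?_⟩
  by_cases hiJ : i ∈ J
  · have hi' : i ∉ J' := fun h => hi (Finset.mem_inter.2 ⟨hiJ, h⟩)
    exact hM.abs_le_radius_of_lift Finset.inter_subset_right hJ' hx' hu hu0
      (fun j _ => (norm_le_pi_norm z j).trans hnorm) hi'
  · exact hM.abs_le_radius_of_lift Finset.inter_subset_left hJ hx hu hu0
      (fun j _ => (norm_le_pi_norm z j).trans hnorm) hiJ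

/-- Two tubes meet modulo the lattice only through translations supported on their index sets. -/
lemma eq_zero_of_mem_tube {J' : Finset (Fin n)} (hq : q * (2 * ρ) < 1) {x : Fin n → ℝ}
    {k : Fin n → ℤ} (hx : x ∈ tube M J (radius c κ ρ J))
    (hx' : x + M *ᵥ intVec k ∈ tube M J' (radius c κ ρ J')) {i : Fin n} (hi : i ∉ J)
    (hi' : i ∉ J') : k i = 0 := by
  obtain ⟨u, hu, hu1, -⟩ := hx
  obtain ⟨v, hv, hv1, -⟩ := hx'
  have h1 : ∀ j, |(x + M *ᵥ intVec k - M *ᵥ v - (x - M *ᵥ u)) j| ≤ 2 * ρ := fun j => by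
    have h2 := (hu1 j).trans (hM.radius_le hρ)
    have h3 := (hv1 j).trans (hM.radius_le hρ)
    have h4 := abs_sub ((x + M *ᵥ intVec k - M *ᵥ v) j) ((x - M *ᵥ u) j)
    rw [← Pi.sub_apply] at h4
    linarith
  have h2 := hM.inv_bound _ _ h1 i
  -- Applying `M⁻¹` bounds every coordinate of `k - v + u` by `2qρ < 1`; at an index outside both
  -- sets this coordinate is the integer `k i`.
  have h3 : x + M *ᵥ intVec k - M *ᵥ v - (x - M *ᵥ u) = M *ᵥ (intVec k - v + u) := by
    rw [Matrix.mulVec_add, Matrix.mulVec_sub]; abel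
  rw [h3, Matrix.mulVec_mulVec, Matrix.nonsing_inv_mul _ hM.isUnit_det, Matrix.one_mulVec] at h2
  simp only [Pi.add_apply, Pi.sub_apply, hu i hi, hv i hi', sub_zero, add_zero, intVec_apply] at h2
  have h4 : |(k i : ℝ)| < 1 := h2.trans_lt hq
  exact Int.abs_lt_one_iff.1 (by exact_mod_cast h4)

/-- The translation is supported on `J ∪ J'`. Its part on `J` preserves the first tube and the
remainder, supported on `J'`, preserves the second, so one translate lies in both. -/
lemma exists_mem_inter {J' : Finset (Fin n)} (hq : q * (2 * ρ) < 1) {x : Fin n → ℝ}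
    {k : Fin n → ℤ} (hx : x ∈ tube M J (radius c κ ρ J))
    (hx' : x + M *ᵥ intVec k ∈ tube M J' (radius c κ ρ J')) :
    ∃ l : Fin n → ℤ, SuppOn J (intVec l) ∧ x + M *ᵥ intVec l ∈ tube M J (radius c κ ρ J) ∧
      x + M *ᵥ intVec l ∈ tube M J' (radius c κ ρ J') := by
  have hk := fun i => hM.eq_zero_of_mem_tube hρ hq hx hx' (i := i)
  have hl : SuppOn J (intVec fun i => if i ∈ J then k i else 0) := fun i hi => by simp [hi]
  refine ⟨_, hl, tube_add_mulVec hx hl, ?_⟩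
  have h1 : SuppOn J' (intVec (fun i => if i ∈ J then k i else 0) - intVec k) := fun i hi => by
    by_cases hiJ : i ∈ J
    · simp [hiJ]
    · simp [hiJ, hk i hiJ hi]
  have := tube_add_mulVec hx' h1
  rwa [Matrix.mulVec_sub, add_assoc, add_sub_cancel] at this

end Dominant

/-! ### Pieces: disjointness, covering and box-shaped slices -/

/-- The points of the tube of `J` with reduced coordinates along the columns in `J` that lie,
modulo the lattice, in no tube of a proper subset of `J`. -/
def piece (M : Matrix (Fin n) (Fin n) ℝ) (c κ ρ : ℝ) (J : Finset (Fin n)) : Set (Fin n → ℝ) :=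
  {x | (∃ u, SuppOn J u ∧ (∀ j, u j ∈ Set.Ioc (-(1 / 2) : ℝ) (1 / 2)) ∧
      x - M *ᵥ u ∈ cubeSlice J (radius c κ ρ J)) ∧
    ∀ I, I ⊂ J → ∀ k : Fin n → ℤ, x + M *ᵥ intVec k ∉ tube M I (radius c κ ρ I)}

lemma mem_tube_of_mem_piece {x : Fin n → ℝ} (hx : x ∈ piece M c κ ρ J) :
    x ∈ tube M J (radius c κ ρ J) := by
  obtain ⟨⟨u, hu, -, h⟩, -⟩ := hx
  exact ⟨u, hu, h⟩

lemma piece_empty : piece M c κ ρ ∅ = cube n ρ := by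
  ext x
  constructor
  · rintro ⟨⟨u, hu, -, h, -⟩, -⟩
    have hu0 : u = 0 := funext fun i => hu i (by simp)
    simpa [hu0, radius] using h
  · intro hx
    refine ⟨⟨0, fun _ _ => rfl, fun j => by constructor <;> norm_num, ?_, by simp⟩,
      fun I hI => absurd hI (Finset.not_ssubset_empty I)⟩
    simpa [radius] using hx

namespace Dominant

variable (hM : Dominant c κ q M) (hρ : 0 < ρ)
include hM hρ

/-- A common orbit meets the tube of `J ∩ J'`, so minimality of each index set forces `J = J'`. The
translation then relates two coordinate vectors in `(-1/2, 1/2]` that differ by integers. -/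
lemma eq_of_mem_piece {J' : Finset (Fin n)} (hq : q * (2 * ρ) < 1) (hJ : J.card * κ ≤ c / 12)
    (hJ' : J'.card * κ ≤ c / 12) {x : Fin n → ℝ} {k : Fin n → ℤ} (hx : x ∈ piece M c κ ρ J)
    (hx' : x + M *ᵥ intVec k ∈ piece M c κ ρ J') : J = J' ∧ k = 0 := by
  have hJJ : J = J' := by
    obtain ⟨l, -, h1, h2⟩ := hM.exists_mem_inter hρ hq (mem_tube_of_mem_piece hx)
      (mem_tube_of_mem_piece hx')
    have h3 := hM.mem_tube_inter hρ hJ hJ' h1 h2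
    have e1 : J ∩ J' = J := by
      by_contra h
      exact hx.2 _ (Finset.ssubset_iff_subset_ne.2 ⟨Finset.inter_subset_left, h⟩) l h3
    have e2 : J ∩ J' = J' := by
      by_contra h
      refine hx'.2 _ (Finset.ssubset_iff_subset_ne.2 ⟨Finset.inter_subset_right, h⟩) (l - k) ?_
      rw [add_assoc, ← Matrix.mulVec_add, ← intVec_add, add_sub_cancel]
      exact h3
    rw [← e1, e2]
  subst hJJ
  refine ⟨rfl, ?_⟩
  have hk : SuppOn J (intVec k) := fun i hi => by
    simpa using hM.eq_zero_of_mem_tube hρ hq (mem_tube_of_mem_piece hx)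
      (mem_tube_of_mem_piece hx') hi hi
  obtain ⟨⟨u, hu, hu1, -, hu2⟩, -⟩ := hx
  obtain ⟨⟨v, hv, hv1, -, hv2⟩, -⟩ := hx'
  have huv : u + intVec k = v := hM.eq_of_lift hJ (hu.add hk) hv fun j hj => by
    have h1 := hu2 j hj
    have h2 := hv2 j hj
    simp only [Matrix.mulVec_add, Pi.add_apply, Pi.sub_apply] at h1 h2 ⊢
    linarith
  funext i
  have h1 := hu1 i
  have h2 := hv1 i
  have h3 := congrFun huv i
  simp only [Pi.add_apply, intVec_apply] at h3
  have h4 : (k i : ℝ) < 1 := by linarith [h1.1, h2.2]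
  have h5 : (-1 : ℝ) < k i := by linarith [h1.2, h2.1]
  have h4' : k i < 1 := by exact_mod_cast h4
  have h5' : -1 < k i := by exact_mod_cast h5
  simp only [Pi.zero_apply]
  omega

-- Take a minimal subset of `J` whose tube meets the orbit of `x`, then reduce the coordinates along
-- its columns.
omit hM hρ in
lemma exists_mem_piece {x : Fin n → ℝ} (hx : x ∈ tube M J (radius c κ ρ J)) :
    ∃ I ⊆ J, ∃ k : Fin n → ℤ, x + M *ᵥ intVec k ∈ piece M c κ ρ I := by
  classical
  let S := J.powerset.filter fun I => ∃ k : Fin n → ℤ,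
    x + M *ᵥ intVec k ∈ tube M I (radius c κ ρ I)
  have hS : S.Nonempty := ⟨J, Finset.mem_filter.2 ⟨Finset.mem_powerset_self J, 0, by simpa⟩⟩
  obtain ⟨I, hI⟩ := S.exists_minimal hS
  obtain ⟨hIJ, k, u, hu, h⟩ := Finset.mem_filter.1 hI.prop
  rw [Finset.mem_powerset] at hIJ
  let l : Fin n → ℤ := fun j => -⌈u j - 1 / 2⌉
  refine ⟨I, hIJ, k + l, ⟨u + intVec l, ?_, fun j => ?_, ?_⟩, ?_⟩
  · refine hu.add fun i hi => ?_
    -- A zero coordinate rounds to zero, so the reducing translation is supported on `I`.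
    have : ⌈(0 : ℝ) - 1 / 2⌉ = 0 := by rw [Int.ceil_eq_iff]; norm_num
    simp only [intVec_apply, l, hu i hi, this]; simp
  · have h1 := Int.le_ceil (u j - 1 / 2)
    have h2 := Int.ceil_lt_add_one (u j - 1 / 2)
    simp only [Pi.add_apply, intVec_apply, l, Int.cast_neg]
    constructor <;> linarith
  · rwa [intVec_add, Matrix.mulVec_add, Matrix.mulVec_add, ← add_assoc, add_sub_add_right_eq_sub]
  · intro I' hI' k' hk'
    rw [add_assoc, ← Matrix.mulVec_add, ← intVec_add] at hk'
    have hmem : I' ∈ S := Finset.mem_filter.2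
      ⟨Finset.mem_powerset.2 (hI'.subset.trans hIJ), _, hk'⟩
    exact hI'.not_subset (hI.le_of_le hmem hI'.subset)

/-- The slices of a piece by the directions off `J` are boxes. -/
lemma add_mem_piece (hq : q * (2 * ρ) < 1) (hJ : J.card * κ ≤ c / 12) {x y : Fin n → ℝ}
    (hx : x ∈ piece M c κ ρ J) (hy : ∀ j ∈ J, y j = 0)
    (hxy : x + y ∈ tube M J (radius c κ ρ J)) : x + y ∈ piece M c κ ρ J := by
  have hxT := mem_tube_of_mem_piece hx
  obtain ⟨⟨u, hu, hu1, hu2⟩, hx3⟩ := hx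
  constructor
  · obtain ⟨v, hv, hv2⟩ := hxy
    have huv : u = v := hM.eq_of_lift hJ hu hv fun j hj => by
      have h1 := hu2.2 j hj
      have h2 := hv2.2 j hj
      simp only [Pi.add_apply, Pi.sub_apply, hy j hj] at h1 h2
      linarith
    subst huv
    exact ⟨u, hu, hu1, hv2⟩
  -- If `x + y` met the tube of `I` modulo the lattice, so would `x` with the same lift: on `J` the
  -- shift `y` is invisible, and off `J` membership in the tube of `J` controls the coordinates.
  · intro I hI k hk
    obtain ⟨l, hl, h1, v, hv, hv1, hv0⟩ := hM.exists_mem_inter hρ hq hxy hk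
    have hxl := tube_add_mulVec hxT hl
    have heq : x + M *ᵥ intVec l - M *ᵥ v = x + y + M *ᵥ intVec l - M *ᵥ v - y := by abel
    have h0 : ∀ j ∈ I, (x + M *ᵥ intVec l - M *ᵥ v) j = 0 := fun j hj => by
      rw [heq, Pi.sub_apply, hv0 j hj, hy j (hI.subset hj), sub_zero]
    have hb : ∀ j ∈ J, |(x + M *ᵥ intVec l - M *ᵥ v) j| ≤ radius c κ ρ I := fun j hj => by
      rw [heq, Pi.sub_apply, hy j hj, sub_zero]
      exact hv1 j
    have hIc := card_mul_le_of_subset hM hI.subset hJ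
    have hr := hM.le_radius hρ hIc
    have hr' := hM.radius_le hρ (J := I)
    refine hx3 I hI l ⟨v, hv, mem_cubeSlice_of (by linarith) h0 fun i hi => ?_⟩
    by_cases hiJ : i ∈ J
    · exact hb i hiJ
    · refine hM.abs_le_radius_of_lift hI.subset hJ hxl hv h0 (fun j hj => ?_) hiJ
      linarith [hb j (Finset.mem_sdiff.1 hj).1]

/-! ### Points with few large coordinates -/

omit hM hρ in
lemma card_mul_le_sum_ite {s : ℝ} {x : Fin n → ℝ}
    (hx : ∑ j, (if ρ / 3 < |x j| then |x j| else 0) ≤ s) (hJ : ∀ j ∈ J, ρ / 3 < |x j|) :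
    (J.card : ℝ) * (ρ / 3) ≤ s ∧ ∑ j ∈ J, |x j| ≤ s := by
  have h1 : ∑ j ∈ J, |x j| ≤ s := by
    refine le_trans ?_ hx
    calc ∑ j ∈ J, |x j| = ∑ j ∈ J, (if ρ / 3 < |x j| then |x j| else 0) :=
          Finset.sum_congr rfl fun j hj => (if_pos (hJ j hj)).symm
      _ ≤ _ := Finset.sum_le_univ_sum_of_nonneg fun j => by split_ifs <;> positivity
  refine ⟨?_, h1⟩
  have := Finset.card_nsmul_le_sum J (fun j => |x j|) (ρ / 3) fun j hj => (hJ j hj).le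
  rw [nsmul_eq_mul] at this
  exact this.trans h1

/-- A point with few large coordinates lies in the tube of its large coordinates. -/
lemma mem_tube_large {s : ℝ} (hs : κ * s ≤ c * ρ / 36) {x : Fin n → ℝ}
    (hx : ∑ j, (if ρ / 3 < |x j| then |x j| else 0) ≤ s) :
    ((Finset.univ.filter fun j => ρ / 3 < |x j|).card : ℝ) * κ ≤ c / 12 ∧
      x ∈ tube M (Finset.univ.filter fun j => ρ / 3 < |x j|)
        (radius c κ ρ (Finset.univ.filter fun j => ρ / 3 < |x j|)) := by
  set J := Finset.univ.filter fun j => ρ / 3 < |x j| with hJdef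
  obtain ⟨h1, h2⟩ := card_mul_le_sum_ite hx (J := J) fun j hj => (Finset.mem_filter.1 hj).2
  -- Each index of `J` contributes more than `ρ / 3` to a sum of at most `s`, and `κ s ≤ c ρ / 36`.
  have hJ : J.card * κ ≤ c / 12 := by
    have := mul_le_mul_of_nonneg_left h1 hM.κ_nonneg
    have h3 : (J.card * κ) * ρ ≤ c / 12 * ρ := by linarith
    exact le_of_mul_le_mul_right h3 hρ
  refine ⟨hJ, ?_⟩
  obtain ⟨u, hu, hu0⟩ := hM.exists_lift hJ x
  have hr := hM.le_radius hρ hJ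
  refine ⟨u, hu, mem_cubeSlice_of (by linarith) hu0 fun i hi => ?_⟩
  have h3 : |x i| ≤ ρ / 3 := by
    by_contra h
    exact hi (Finset.mem_filter.2 ⟨Finset.mem_univ i, not_le.1 h⟩)
  have h4 := hM.abs_mulVec_le hu hi
  have h5 := hM.sum_abs_le hJ hu
  have h6 : ∑ j ∈ J, |(M *ᵥ u) j| = ∑ j ∈ J, |x j| := Finset.sum_congr rfl fun j hj => by
    have := hu0 j hj
    rw [Pi.sub_apply, sub_eq_zero] at this
    rw [this]
  have hc := hM.c_pos
  have h7 : κ * ∑ j ∈ J, |u j| ≤ ρ / 18 := by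
    calc κ * ∑ j ∈ J, |u j| ≤ κ * (2 / c * s) := by
          refine mul_le_mul_of_nonneg_left (h5.trans ?_) hM.κ_nonneg
          rw [h6]
          exact mul_le_mul_of_nonneg_left h2 (by positivity)
      _ = 2 / c * (κ * s) := by ring
      _ ≤ 2 / c * (c * ρ / 36) := mul_le_mul_of_nonneg_left hs (by positivity)
      _ = ρ / 18 := by field_simp; norm_num
  -- Off `J` the total is at most `ρ/3 + ρ/18`, below the least radius `2ρ/3`.
  have h8 := abs_sub (x i) ((M *ᵥ u) i)
  rw [Pi.sub_apply]
  linarith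

/-- A point of a piece with a representative in the cell having few large coordinates has small
coordinates along the columns. -/
lemma sum_abs_le_of_mem_piece {s : ℝ} (hs : κ * s ≤ c * ρ / 36) (hq : q * (4 * ρ) ≤ 1)
    (hJ : J.card * κ ≤ c / 12) {x u : Fin n → ℝ} (hx : x ∈ piece M c κ ρ J) (hu : SuppOn J u)
    (hu1 : ∀ j, u j ∈ Set.Ioc (-(1 / 2) : ℝ) (1 / 2)) (hu0 : ∀ j ∈ J, (x - M *ᵥ u) j = 0)
    {k : Fin n → ℤ} (hcell : x + M *ᵥ intVec k ∈ cell M)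
    (hk : ∑ j, (if ρ / 3 < |(x + M *ᵥ intVec k) j| then |(x + M *ᵥ intVec k) j| else 0) ≤ s) :
    ∑ j ∈ J, |u j| ≤ 2 / c * s := by
  have hqρ : q * (2 * ρ) < 1 := by linarith
  have hxT := mem_tube_of_mem_piece hx
  obtain ⟨hJ0, hT⟩ := hM.mem_tube_large hρ hs hk
  set x' := x + M *ᵥ intVec k with hx'
  set J0 := Finset.univ.filter fun j => ρ / 3 < |x' j| with hJ0def
  -- Otherwise a translate of `x` would lie in the tube of the proper subset `J ∩ J0`.
  have hsub : J ⊆ J0 := by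
    obtain ⟨l, -, h1, h2⟩ := hM.exists_mem_inter hρ hqρ hxT hT
    have h3 := hM.mem_tube_inter hρ hJ hJ0 h1 h2
    by_contra h
    refine hx.2 _ (Finset.ssubset_iff_subset_ne.2 ⟨Finset.inter_subset_left, fun h' => h ?_⟩) l h3
    exact Finset.inter_eq_left.1 h'
  obtain ⟨-, hsum⟩ := card_mul_le_sum_ite hk (J := J) fun j hj =>
    (Finset.mem_filter.1 (hsub hj)).2
  -- Off `J` the column coordinates of `x` are at most `qρ ≤ 1/4` and those of the cell point at
  -- most `1/2`, so the integer `k i` has absolute value below `1`.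
  have hksupp : SuppOn J (intVec k) := fun i hi => by
    obtain ⟨v, hv, hv1, -⟩ := hxT
    obtain ⟨t, ht, htx⟩ := hcell
    have h1 := hM.inv_bound _ _ (fun j => (hv1 j).trans (hM.radius_le hρ)) i
    have h2 : x - M *ᵥ v = M *ᵥ (t - intVec k - v) := by
      rw [Matrix.mulVec_sub, Matrix.mulVec_sub, ← htx, hx']; abel
    rw [h2, Matrix.mulVec_mulVec, Matrix.nonsing_inv_mul _ hM.isUnit_det, Matrix.one_mulVec] at h1
    simp only [Pi.sub_apply, hv i hi, sub_zero, intVec_apply] at h1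
    have h3 := abs_le.1 h1
    have h4 := ht i
    have h5 : (k i : ℝ) < 1 := by linarith [h4.2]
    have h6 : (-1 : ℝ) < k i := by linarith [h4.1]
    have h5' : k i < 1 := by exact_mod_cast h5
    have h6' : -1 < k i := by exact_mod_cast h6
    have : k i = 0 := by omega
    simp [this]
  -- A number in `(-1/2, 1/2]` has the least absolute value in its class modulo the integers.
  have h1 : ∑ j ∈ J, |u j| ≤ ∑ j ∈ J, |(u + intVec k) j| := Finset.sum_le_sum fun j _ => by
    obtain ⟨h2, h3⟩ := hu1 j
    have h4 : |u j| ≤ 1 / 2 := abs_le.2 ⟨by linarith, h3⟩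
    by_cases h5 : k j = 0
    · simp [h5]
    · have h6 : (1 : ℝ) ≤ |(k j : ℝ)| := by exact_mod_cast Int.one_le_abs h5
      have h7 := abs_sub_abs_le_abs_sub (k j : ℝ) (-u j)
      rw [abs_neg, sub_neg_eq_add, add_comm (k j : ℝ)] at h7
      simp only [Pi.add_apply, intVec_apply]
      linarith
  refine h1.trans ((hM.sum_abs_le hJ (hu.add hksupp)).trans ?_)
  have h2 : ∑ j ∈ J, |(M *ᵥ (u + intVec k)) j| = ∑ j ∈ J, |x' j| :=
    Finset.sum_congr rfl fun j hj => by
      have := hu0 j hj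
      rw [Pi.sub_apply, sub_eq_zero] at this
      rw [Matrix.mulVec_add, hx', Pi.add_apply, Pi.add_apply, this]
  rw [h2]
  exact mul_le_mul_of_nonneg_left hsum (by have := hM.c_pos; positivity)

/-- The coordinates in `J` of a point of the piece of `J` are not small. -/
lemma lt_abs_of_mem_piece {s : ℝ} (hs : κ * s ≤ c * ρ / 36) (hJ : J.card * κ ≤ c / 12)
    {x u : Fin n → ℝ} (hx : x ∈ piece M c κ ρ J) (hu : SuppOn J u)
    (hu0 : ∀ j ∈ J, (x - M *ᵥ u) j = 0) (hus : ∑ j ∈ J, |u j| ≤ 2 / c * s) {j : Fin n}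
    (hj : j ∈ J) : ρ / 9 < |x j| := by
  by_contra! hxj
  -- If `x j` is small, dropping `j` from the projection still leaves a small residual, so `x` lies
  -- in the tube of `J.erase j`, against minimality.
  have hIJ : J.erase j ⊂ J := Finset.erase_ssubset hj
  have hI := card_mul_le_of_subset hM hIJ.subset hJ
  obtain ⟨v, hv, hv0⟩ := hM.exists_lift hI x
  have hc := hM.c_pos
  have hr := hM.le_radius hρ hI
  have hκ : κ ≤ c / 12 := by
    refine le_trans ?_ hJ
    have : (1 : ℝ) ≤ J.card := by exact_mod_cast Finset.card_pos.2 ⟨j, hj⟩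
    exact le_mul_of_one_le_left hM.κ_nonneg this
  have hsd : J \ J.erase j = {j} := by
    ext i
    simp only [Finset.mem_sdiff, Finset.mem_erase, Finset.mem_singleton, not_and]
    constructor
    · rintro ⟨h1, h2⟩
      by_contra h
      exact h2 h h1
    · rintro rfl
      exact ⟨hj, fun h => absurd rfl h⟩
  set z := x - M *ᵥ v with hz
  have hvs : ∑ i ∈ J, |v i| ≤ 2 / c * s + 2 / c * |z j| := by
    have h1 := hM.sum_abs_le hJ ((hv.mono hIJ.subset).sub hu)
    have h2 : ∑ i ∈ J, |(M *ᵥ (v - u)) i| = |z j| := by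
      rw [Finset.sum_eq_single_of_mem j hj]
      · have := hu0 j hj
        rw [Pi.sub_apply, sub_eq_zero] at this
        rw [Matrix.mulVec_sub, Pi.sub_apply, ← this, hz, Pi.sub_apply, abs_sub_comm]
      · intro i hi hij
        have h3 := hu0 i hi
        have h4 := hv0 i (Finset.mem_erase.2 ⟨hij, hi⟩)
        rw [Pi.sub_apply, sub_eq_zero] at h3
        rw [hz, Pi.sub_apply, sub_eq_zero] at h4
        rw [Matrix.mulVec_sub, Pi.sub_apply, ← h3, ← h4, sub_self, abs_zero]
    rw [h2] at h1
    have h3 : ∑ i ∈ J, |v i| ≤ ∑ i ∈ J, |u i| + ∑ i ∈ J, |(v - u) i| := by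
      rw [← Finset.sum_add_distrib]
      refine Finset.sum_le_sum fun i _ => ?_
      have := abs_add_le (u i) ((v - u) i)
      simpa using this
    linarith
  -- The estimate closes on itself: `|z j| ≤ ρ/9 + ρ/18 + |z j|/6`.
  have hzj : |z j| ≤ 2 / 3 * ρ := by
    have h1 := hM.abs_mulVec_le hv (Finset.notMem_erase j J)
    have h2 : ∑ i ∈ J.erase j, |v i| ≤ ∑ i ∈ J, |v i| :=
      Finset.sum_le_sum_of_subset_of_nonneg hIJ.subset fun _ _ _ => abs_nonneg _
    have h3 := abs_sub (x j) ((M *ᵥ v) j)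
    rw [← Pi.sub_apply, ← hz] at h3
    have h4 := mul_le_mul_of_nonneg_left (h2.trans hvs) hM.κ_nonneg
    have h5 : κ * (2 / c * s + 2 / c * |z j|) = 2 / c * (κ * s) + 2 / c * κ * |z j| := by ring
    have h6 : 2 / c * (κ * s) ≤ ρ / 18 := by
      calc 2 / c * (κ * s) ≤ 2 / c * (c * ρ / 36) := mul_le_mul_of_nonneg_left hs (by positivity)
        _ = ρ / 18 := by field_simp; norm_num
    have h7 : 2 / c * κ * |z j| ≤ 1 / 6 * |z j| := by
      refine mul_le_mul_of_nonneg_right ?_ (abs_nonneg _)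
      rw [div_mul_eq_mul_div, div_le_iff₀ hc]; linarith
    rw [h5] at h4
    linarith
  refine hx.2 _ hIJ 0 ?_
  rw [intVec_zero, Matrix.mulVec_zero, add_zero]
  refine ⟨v, hv, mem_cubeSlice_of (by linarith) hv0 fun i hi => ?_⟩
  by_cases hij : i = j
  · rw [hij]; linarith
  · have hiJ : i ∉ J := fun h => hi (Finset.mem_erase.2 ⟨hij, h⟩)
    refine hM.abs_le_radius_of_lift hIJ.subset hJ (mem_tube_of_mem_piece hx) hv hv0
      (fun l hl => ?_) hiJ
    rw [hsd, Finset.mem_singleton] at hl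
    rw [hl]; linarith

end Dominant

/-! ### Rearranging a fundamental domain -/

section Decomposition

variable {V ι : Type*} [AddCommGroup V] [MeasurableSpace V] [MeasurableAdd V] {μ : Measure V}
  [μ.IsAddLeftInvariant] {G : AddSubgroup V} [Countable G] {D : Set V} {s : Finset ι} {T : ι → Set V}

/-- The points none of whose translates by `G` lies in a member of the family. -/
def unmet (G : AddSubgroup V) (s : Finset ι) (T : ι → Set V) : Set V :=
  {x | ∀ g : G, ∀ i ∈ s, (g : V) + x ∉ T i}

omit [μ.IsAddLeftInvariant] in
lemma measurableSet_unmet (hT : ∀ i ∈ s, MeasurableSet (T i)) : MeasurableSet (unmet G s T) := by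
  have : unmet G s T = ⋂ g : G, ⋂ i ∈ s, (fun x => (g : V) + x) ⁻¹' (T i)ᶜ := by
    ext x; simp [unmet]
  rw [this]
  exact MeasurableSet.iInter fun g => Finset.measurableSet_biInter _ fun i hi =>
    measurable_const_add _ (hT i hi).compl

omit [μ.IsAddLeftInvariant] in
/-- A fundamental domain can be rearranged to contain given measurable sets that are disjoint
modulo the group. -/
lemma isAddFundamentalDomain_rearrange (hD : MeasurableSet D)
    (hD1 : ∀ x : V, ∃! g : G, (g : V) + x ∈ D) (hT : ∀ i ∈ s, MeasurableSet (T i))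
    (hdis : ∀ i ∈ s, ∀ j ∈ s, ∀ x ∈ T i, ∀ g : G, (g : V) + x ∈ T j → i = j ∧ g = 0) :
    IsAddFundamentalDomain G ((⋃ i ∈ s, T i) ∪ (D ∩ unmet G s T)) μ := by
  refine IsAddFundamentalDomain.mk' (MeasurableSet.nullMeasurableSet
    ((Finset.measurableSet_biUnion _ hT).union (hD.inter (measurableSet_unmet hT)))) fun x => ?_
  simp only [AddSubgroup.vadd_def, vadd_eq_add, Set.mem_union, Set.mem_iUnion, Set.mem_inter_iff,
    exists_prop]
  -- An orbit missing every `T i` is represented once in `D`; any other orbit is represented once in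
  -- the union of the `T i`, by disjointness modulo the group.
  by_cases hx : x ∈ unmet G s T
  · have hx' : ∀ g : G, (g : V) + x ∈ unmet G s T := fun g h i hi => by
      rw [← add_assoc]; exact hx (h + g) i hi
    obtain ⟨g, hg, hg'⟩ := hD1 x
    refine ⟨g, Or.inr ⟨hg, hx' g⟩, ?_⟩
    rintro h (⟨i, hi, hh⟩ | ⟨hh, -⟩)
    · exact absurd hh (hx h i hi)
    · exact hg' h hh
  · simp only [unmet, Set.mem_ofPred_eq, not_forall, not_not] at hx
    obtain ⟨g, i, hi, hg⟩ := hx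
    refine ⟨g, Or.inl ⟨i, hi, hg⟩, ?_⟩
    rintro h (⟨j, hj, hh⟩ | ⟨-, hh⟩)
    · have := (hdis i hi j hj _ hg (h - g) (by
        rw [AddSubgroup.coe_sub, ← add_assoc, sub_add_cancel]; exact hh)).2
      exact sub_eq_zero.1 this
    · refine absurd hg ?_
      have := hh (g - h) i hi
      rwa [AddSubgroup.coe_sub, ← add_assoc, sub_add_cancel] at this

lemma setIntegral_eq_sum_add {E : Type*} [NormedAddCommGroup E] [NormedSpace ℝ E] {f : V → E}
    (hD : MeasurableSet D)
    (hD1 : ∀ x : V, ∃! g : G, (g : V) + x ∈ D) (hT : ∀ i ∈ s, MeasurableSet (T i))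
    (hdis : ∀ i ∈ s, ∀ j ∈ s, ∀ x ∈ T i, ∀ g : G, (g : V) + x ∈ T j → i = j ∧ g = 0)
    (hf : ∀ (g : G) (x : V), f ((g : V) + x) = f x) (hfi : IntegrableOn f D μ) :
    (∀ i ∈ s, IntegrableOn f (T i) μ) ∧
      ∫ x in D, f x ∂μ = (∑ i ∈ s, ∫ x in T i, f x ∂μ) + ∫ x in D ∩ unmet G s T, f x ∂μ := by
  have h1 : IsAddFundamentalDomain G D μ := IsAddFundamentalDomain.mk' hD.nullMeasurableSet hD1
  have h2 := isAddFundamentalDomain_rearrange (μ := μ) hD hD1 hT hdis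
  have h3 : IntegrableOn f ((⋃ i ∈ s, T i) ∪ (D ∩ unmet G s T)) μ :=
    (h1.integrableOn_iff h2 hf).1 hfi
  have h4 : ∀ i ∈ s, IntegrableOn f (T i) μ := fun i hi => h3.mono_set
    ((Set.subset_biUnion_of_mem (u := T) (Finset.mem_coe.2 hi)).trans Set.subset_union_left)
  refine ⟨h4, ?_⟩
  rw [h1.setIntegral_eq h2 hf, setIntegral_union _ (hD.inter (measurableSet_unmet hT))
    (h3.mono_set Set.subset_union_left) (h3.mono_set Set.subset_union_right),
    integral_biUnion_finset _ hT _ h4]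
  · intro i hi j hj hij
    refine Set.disjoint_left.2 fun x hx hx' => hij (hdis i hi j hj x hx 0 ?_).1
    simpa using hx'
  · refine Set.disjoint_left.2 fun x hx hx' => ?_
    simp only [Set.mem_iUnion, exists_prop] at hx
    obtain ⟨i, hi, hx⟩ := hx
    exact hx'.2 0 i hi (by simpa using hx)

end Decomposition

/-! ### Slicing by Fubini -/

section Slices

/-- The vector with prescribed coordinates in `J` and off `J`. -/
def merge (J : Finset (Fin n)) (p : ({j // j ∈ J} → ℝ) × ({j // j ∉ J} → ℝ)) : Fin n → ℝ :=
  fun i => if h : i ∈ J then p.1 ⟨i, h⟩ else p.2 ⟨i, h⟩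

lemma measurePreserving_merge : MeasurePreserving (merge J) volume volume := by
  have h := (volume_preserving_piEquivPiSubtypeProd (fun _ : Fin n => ℝ) (fun j => j ∈ J)).symm
  rw [Subsingleton.elim (Subtype.fintype fun j => j ∈ J) (Finset.Subtype.fintype J)] at h
  exact h

lemma measurableEmbedding_merge : MeasurableEmbedding (merge J) :=
  (MeasurableEquiv.piEquivPiSubtypeProd (fun _ : Fin n => ℝ)
    (fun j => j ∈ J)).symm.measurableEmbedding

lemma integral_merge {E : Type*} [NormedAddCommGroup E] [NormedSpace ℝ E] {f : (Fin n → ℝ) → E}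
    (hf : Integrable f) : Integrable (fun w => ∫ y, f (merge J (w, y))) ∧
      ∫ x, f x = ∫ w, ∫ y, f (merge J (w, y)) := by
  have h1 : Integrable (fun p => f (merge J p)) :=
    (measurePreserving_merge.integrable_comp_emb measurableEmbedding_merge).2 hf
  refine ⟨h1.integral_prod_left, ?_⟩
  rw [← measurePreserving_merge.integral_comp measurableEmbedding_merge (g := f)]
  exact integral_prod _ h1

/-- If on every slice of `E` meeting the complement of `A` the integral of `H` is at most `ℓ`, then
off `A` the integral over `E` is at most `ℓ` times the volume of the set of slices. -/
lemma norm_setIntegral_le_of_slices {E A : Set (Fin n → ℝ)} {H : (Fin n → ℝ) → ℂ} {R ℓ : ℝ}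
    (hE : MeasurableSet E) (hA : NullMeasurableSet A) (hH : IntegrableOn H E) (hR : 0 ≤ R)
    (hℓ : 0 ≤ ℓ) (hER : ∀ x ∈ E, ∀ j ∈ J, |x j| ≤ R / 2)
    (hslice : ∀ w y, merge J (w, y) ∈ E → merge J (w, y) ∉ A →
      ‖∫ y in {y | merge J (w, y) ∈ E}, H (merge J (w, y))‖ ≤ ℓ) :
    ‖∫ x in E, H x‖ ≤ (∫ x in E, A.indicator (fun x => ‖H x‖) x) + R ^ J.card * ℓ := by
  have hf : Integrable (E.indicator H) := (integrable_indicator_iff hE).2 hH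
  have hg : Integrable (E.indicator (A.indicator fun x => ‖H x‖)) := by
    rw [integrable_indicator_iff hE]
    exact hH.norm.indicator₀ (hA.mono_ac Measure.restrict_le_self.absolutelyContinuous)
  obtain ⟨hf1, hf2⟩ := integral_merge (J := J) hf
  obtain ⟨hg1, hg2⟩ := integral_merge (J := J) hg
  let box : Set ({j // j ∈ J} → ℝ) := Set.Icc (fun _ => -(R / 2)) (fun _ => R / 2)
  have hbox : volume box ≠ ⊤ := by
    rw [Real.volume_Icc_pi]; exact ENNReal.prod_ne_top fun _ _ => ENNReal.ofReal_ne_top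
  have hboxm : MeasurableSet box := measurableSet_Icc
  have hb1 : Integrable (box.indicator fun _ => ℓ) :=
    (integrable_indicator_iff hboxm).2 (integrableOn_const hbox)
  have hb2 : ∫ w, box.indicator (fun _ => ℓ) w = R ^ J.card * ℓ := by
    rw [integral_indicator_const _ hboxm, smul_eq_mul, Measure.real, Real.volume_Icc_pi_toReal]
    · simp
    · intro _; linarith
  rw [← integral_indicator hE, ← integral_indicator hE, hf2, hg2, ← hb2, ← integral_add hg1 hb1]
  refine (norm_integral_le_integral_norm _).trans (integral_mono_of_nonneg
    (Filter.Eventually.of_forall fun _ => norm_nonneg _) (hg1.add hb1)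
    (Filter.Eventually.of_forall fun w => ?_))
  simp only
  have hg0 : ∀ x, 0 ≤ E.indicator (A.indicator fun x => ‖H x‖) x := fun x =>
    Set.indicator_nonneg (fun _ _ => Set.indicator_nonneg (fun _ _ => norm_nonneg _) _) _
  have hℓ0 : 0 ≤ box.indicator (fun _ => ℓ) w := Set.indicator_nonneg (fun _ _ => hℓ) _
  -- A slice with a point off `A` costs `ℓ`, and its parameter lies in a box of side `R`; any other
  -- slice lies in `A` and is paid for by the integral of `‖H‖`.
  by_cases hw : ∃ y, merge J (w, y) ∈ E ∧ merge J (w, y) ∉ A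
  · obtain ⟨y, hy, hyA⟩ := hw
    have hwbox : w ∈ box := by
      have : ∀ j, |w j| ≤ R / 2 := fun j => by
        have := hER _ hy j j.2
        simpa [merge] using this
      exact ⟨fun j => (abs_le.1 (this j)).1, fun j => (abs_le.1 (this j)).2⟩
    have hm : MeasurableSet {y | merge J (w, y) ∈ E} :=
      (measurableEmbedding_merge.measurable.comp measurable_prodMk_left) hE
    have h1 : ∫ y, E.indicator H (merge J (w, y)) =
        ∫ y in {y | merge J (w, y) ∈ E}, H (merge J (w, y)) := by
      rw [← integral_indicator hm]; rfl
    rw [h1, Set.indicator_of_mem hwbox]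
    have := hslice w y hy hyA
    have h2 : 0 ≤ ∫ y, E.indicator (A.indicator fun x => ‖H x‖) (merge J (w, y)) :=
      integral_nonneg fun y => hg0 _
    linarith
  · push Not at hw
    refine (norm_integral_le_integral_norm _).trans ?_
    refine le_trans (le_of_eq ?_) (le_add_of_nonneg_right hℓ0)
    refine integral_congr_ae (Filter.Eventually.of_forall fun y => ?_)
    simp only
    by_cases hy : merge J (w, y) ∈ E
    · rw [Set.indicator_of_mem hy, Set.indicator_of_mem hy, Set.indicator_of_mem (hw y hy)]
    · rw [Set.indicator_of_notMem hy, Set.indicator_of_notMem hy, norm_zero]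

lemma merge_eq_add (w : {j // j ∈ J} → ℝ) (y : {j // j ∉ J} → ℝ) :
    merge J (w, y) = merge J (w, 0) + extendZero J y := by
  funext i
  by_cases hi : i ∈ J <;> simp [merge, extendZero, hi]

end Slices

/-! ### Measurability and the lattice as a group of translations -/

section Measurability

lemma measurableSet_cubeSlice (t : ℝ) : MeasurableSet (cubeSlice J t) := by
  have : cubeSlice J t = (⋂ j, {x | |x j| ≤ t}) ∩ ⋂ j ∈ J, {x | x j = 0} := by
    ext x; simp [mem_cubeSlice]
  rw [this]
  refine (MeasurableSet.iInter fun j => ?_).inter (Finset.measurableSet_biInter _ fun j _ => ?_)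
  · exact measurableSet_le (measurable_pi_apply j).abs measurable_const
  · exact measurableSet_eq_fun (measurable_pi_apply j) measurable_const

namespace Dominant

variable (hM : Dominant c κ q M)
include hM

lemma measurableSet_tube (hJ : J.card * κ ≤ c / 12) (r : ℝ) : MeasurableSet (tube M J r) := by
  obtain ⟨U, hU, hU0⟩ := hM.exists_linear_lift hJ
  have h : tube M J r = (LinearMap.id - M.mulVecLin ∘ₗ U : (Fin n → ℝ) →ₗ[ℝ] (Fin n → ℝ)) ⁻¹' cubeSlice J r := by
    ext x
    constructor
    · rintro ⟨u, hu, h1, h2⟩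
      have : U x = u := hM.eq_of_lift hJ (hU x) hu fun j hj => by
        have := h2 j hj
        rw [Pi.sub_apply, sub_eq_zero] at this
        rw [hU0 x j hj, this]
      subst this
      exact ⟨h1, h2⟩
    · exact fun h => ⟨U x, hU x, h⟩
  rw [h]
  exact (LinearMap.continuous_of_finiteDimensional _).measurable (measurableSet_cubeSlice r)

lemma measurableSet_piece (hJ : J.card * κ ≤ c / 12) : MeasurableSet (piece M c κ ρ J) := by
  obtain ⟨U, hU, hU0⟩ := hM.exists_linear_lift hJ
  have h : piece M c κ ρ J = (U ⁻¹' (⋂ j, {x | x j ∈ Set.Ioc (-(1 / 2) : ℝ) (1 / 2)}) ∩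
      (LinearMap.id - M.mulVecLin ∘ₗ U : (Fin n → ℝ) →ₗ[ℝ] (Fin n → ℝ)) ⁻¹' cubeSlice J (radius c κ ρ J)) ∩
      ⋂ I ∈ J.ssubsets, ⋂ k : Fin n → ℤ,
        ((fun x => x + M *ᵥ intVec k) ⁻¹' tube M I (radius c κ ρ I))ᶜ := by
    ext x
    simp only [piece, Set.mem_ofPred_eq, Set.mem_inter_iff, Set.mem_iInter, Set.mem_compl_iff,
      Set.mem_preimage, Finset.mem_ssubsets]
    refine and_congr_left fun _ => ⟨?_, fun h => ⟨U x, hU x, h.1, h.2⟩⟩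
    rintro ⟨u, hu, hu1, h1, h2⟩
    have : U x = u := hM.eq_of_lift hJ (hU x) hu fun j hj => by
      have := h2 j hj
      rw [Pi.sub_apply, sub_eq_zero] at this
      rw [hU0 x j hj, this]
    subst this
    exact ⟨hu1, h1, h2⟩
  rw [h]
  refine MeasurableSet.inter (MeasurableSet.inter ?_ ?_) ?_
  · refine (LinearMap.continuous_of_finiteDimensional U).measurable
      (MeasurableSet.iInter fun j => measurable_pi_apply j measurableSet_Ioc)
  · exact (LinearMap.continuous_of_finiteDimensional _).measurable (measurableSet_cubeSlice _)
  · refine Finset.measurableSet_biInter _ fun I hI => MeasurableSet.iInter fun k =>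
      MeasurableSet.compl ?_
    have hI' := card_mul_le_of_subset hM (Finset.mem_ssubsets.1 hI).subset hJ
    exact measurable_add_const _ (hM.measurableSet_tube hI' _)

end Dominant

lemma measurableSet_cell (hM : IsUnit M.det) : MeasurableSet (cell M) := by
  have h : cell M = M⁻¹.mulVecLin ⁻¹' (⋂ j, {x | x j ∈ Set.Ioc (-(1 / 2) : ℝ) (1 / 2)}) := by
    ext x
    simp only [Set.mem_preimage, Set.mem_iInter, Matrix.mulVecLin_apply]
    constructor
    · rintro ⟨t, ht, rfl⟩
      rw [Matrix.mulVec_mulVec, Matrix.nonsing_inv_mul M hM, Matrix.one_mulVec]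
      exact ht
    · intro h
      refine ⟨_, h, ?_⟩
      rw [Matrix.mulVec_mulVec, Matrix.mul_nonsing_inv M hM, Matrix.one_mulVec]
  rw [h]
  exact (LinearMap.continuous_of_finiteDimensional _).measurable
    (MeasurableSet.iInter fun j => measurable_pi_apply j measurableSet_Ioc)

/-- The lattice as a subgroup. -/
def latticeSubgroup (M : Matrix (Fin n) (Fin n) ℝ) : AddSubgroup (Fin n → ℝ) where
  carrier := lattice M
  zero_mem' := ⟨0, (by rw [intVec_zero, Matrix.mulVec_zero] : (0 : Fin n → ℝ) = M *ᵥ intVec 0)⟩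
  add_mem' := by
    rintro _ _ ⟨k, rfl⟩ ⟨l, rfl⟩
    exact ⟨k + l, by rw [← Matrix.mulVec_add]; congr 1; funext j; simp⟩
  neg_mem' := by
    rintro _ ⟨k, rfl⟩
    exact ⟨-k, by rw [← Matrix.mulVec_neg]; congr 1; funext j; simp⟩

instance : Countable (latticeSubgroup M) := by
  have : Function.Surjective fun k : Fin n → ℤ =>
      (⟨M *ᵥ intVec k, k, rfl⟩ : latticeSubgroup M) := by
    rintro ⟨_, k, rfl⟩
    exact ⟨k, rfl⟩
  exact this.countable

lemma existsUnique_add_mem_cell (hM : IsUnit M.det) (x : Fin n → ℝ) :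
    ∃! g : latticeSubgroup M, (g : Fin n → ℝ) + x ∈ cell M := by
  obtain ⟨y, ⟨hy, hy1⟩, hy2⟩ := existsUnique_mem_cell hM x
  refine ⟨-⟨x - y, hy1⟩, ?_, fun g hg => ?_⟩
  · simpa using hy
  · have h1 := hy2 (g + x) ⟨hg, by
      rw [sub_add_cancel_right]
      exact (-g).2⟩
    ext1
    simp [← h1]

end Measurability

/-! ### The estimate for one piece -/

lemma NearDiagonal.dominant {C K : ℝ} (hc : 0 < c) (hM : NearDiagonal c C K M) :
    Dominant c (|K| / n) (|C| + |K|) M where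
  c_pos := hc
  κ_nonneg := by positivity
  q_nonneg := by positivity
  isUnit_det := hM.isUnit_det
  diag j := (hM.diag j).1
  off_diag i j hij := (hM.off_diag i j hij).trans
    (div_le_div_of_nonneg_right (le_abs_self K) (Nat.cast_nonneg n))
  inv_bound x r hx i := by
    have hn : (0 : ℝ) < n := Nat.cast_pos.2 (Fin.pos i)
    have hr : 0 ≤ r := (abs_nonneg _).trans (hx i)
    -- Granting `|K| / n` to the diagonal entry as well, the row sums to `|C| + |K|`, independently
    -- of `n`.
    have h1 : ∀ j, |M⁻¹ i j * x j| ≤ ((if i = j then |C| else 0) + |K| / n) * r := fun j => by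
      rw [abs_mul]
      refine mul_le_mul ?_ (hx j) (abs_nonneg _) (by positivity)
      have hK : 0 ≤ |K| / n := by positivity
      by_cases hij : i = j
      · subst hij
        obtain ⟨h2, h3⟩ := hM.diag_inv i
        rw [if_pos rfl, abs_of_pos (hc.trans_le h2)]
        linarith [le_abs_self C]
      · rw [if_neg hij, zero_add]
        exact (hM.off_diag_inv i j hij).trans
          (div_le_div_of_nonneg_right (le_abs_self K) hn.le)
    have h2 : (M⁻¹ *ᵥ x) i = ∑ j, M⁻¹ i j * x j := rfl
    rw [h2]
    refine (Finset.abs_sum_le_sum_abs _ _).trans ((Finset.sum_le_sum fun j _ => h1 j).trans ?_)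
    rw [← Finset.sum_mul, Finset.sum_add_distrib, Finset.sum_ite_eq, if_pos (Finset.mem_univ i),
      Finset.sum_const, Finset.card_univ, Fintype.card_fin, nsmul_eq_mul, mul_div_cancel₀ _ hn.ne']

lemma inftyNorm_nonneg (M : Matrix (Fin n) (Fin n) ℝ) : 0 ≤ inftyNorm M := by
  let _ : NormedAddCommGroup (Matrix (Fin n) (Fin n) ℝ) := Matrix.linftyOpNormedAddCommGroup
  exact norm_nonneg M

lemma abs_mulVec_le_inftyNorm {u : Fin n → ℝ} {r : ℝ} (hr : 0 ≤ r) (hu : ∀ j, |u j| ≤ r)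
    (i : Fin n) : |(M *ᵥ u) i| ≤ inftyNorm M * r :=
  ((norm_le_pi_norm (M *ᵥ u) i).trans (Matrix.linfty_opNorm_mulVec M u)).trans
    (mul_le_mul_of_nonneg_left ((pi_norm_le_iff_of_nonneg hr).2 hu) (inftyNorm_nonneg M))

lemma merge_zero_of_notMem (w : {j // j ∈ J} → ℝ) {i : Fin n} (hi : i ∉ J) :
    merge J (w, 0) i = 0 := by simp [merge, hi]

lemma merge_of_mem (w : {j // j ∈ J} → ℝ) (y : {j // j ∉ J} → ℝ) {i : Fin n} (hi : i ∈ J) :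
    merge J (w, y) i = w ⟨i, hi⟩ := by simp [merge, hi]

lemma merge_of_notMem (w : {j // j ∈ J} → ℝ) (y : {j // j ∉ J} → ℝ) {i : Fin n} (hi : i ∉ J) :
    merge J (w, y) i = y ⟨i, hi⟩ := by simp [merge, hi]

lemma merge_zero_mem_span (w : {j // j ∈ J} → ℝ) :
    merge J (w, 0) ∈ (Submodule.span ℝ ((fun j => Pi.single j (1 : ℝ)) '' (J : Set (Fin n))) :
      Set (Fin n → ℝ)) := by
  have h : merge J (w, 0) = ∑ j ∈ J, merge J (w, 0) j • (Pi.single j (1 : ℝ) : Fin n → ℝ) := by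
    funext i
    simp only [Finset.sum_apply, Pi.smul_apply, Pi.single_apply, smul_eq_mul, mul_ite, mul_one,
      mul_zero, Finset.sum_ite_eq]
    split_ifs with hi
    · rfl
    · exact merge_zero_of_notMem w hi
  rw [h]
  exact Submodule.sum_mem _ fun j hj =>
    Submodule.smul_mem _ _ (Submodule.subset_span ⟨j, hj, rfl⟩)

/-- The box with half-widths `r` centred at the restriction of `s` off `J`. -/
lemma mem_Icc_box {s y : Fin n → ℝ} {r : ℝ} :
    y ∈ Set.Icc (fun i => if i ∈ J then 0 else s i - r) (fun i => if i ∈ J then 0 else s i + r) ↔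
      (∀ i ∈ J, y i = 0) ∧ ∀ i, i ∉ J → |y i - s i| ≤ r := by
  simp only [Set.mem_Icc, Pi.le_def, ← forall_and]
  refine forall_congr' fun i => ?_
  by_cases hi : i ∈ J
  · simp [hi, le_antisymm_iff, and_comm]
  · simp only [hi, if_false, IsEmpty.forall_iff, true_and, forall_true_left, not_false_iff,
      abs_le]
    constructor <;> rintro ⟨h1, h2⟩ <;> constructor <;> linarith

namespace Dominant

variable (hM : Dominant c κ q M) (hρ : 0 < ρ)
include hM hρ

/-- The coordinates in `J` are constant on a slice and determine the lift `u`, so the box is centred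
at `M u` off `J`; `add_mem_piece` shows that all of it belongs to the piece. -/
lemma preimage_piece_eq_box (hq : q * (2 * ρ) < 1) (hJ : J.card * κ ≤ c / 12)
    {w : {j // j ∈ J} → ℝ} {y : {j // j ∉ J} → ℝ} (hx : merge J (w, y) ∈ piece M c κ ρ J)
    {u : Fin n → ℝ} (hu : SuppOn J u) (hu0 : ∀ j ∈ J, (merge J (w, y) - M *ᵥ u) j = 0) :
    {y' | merge J (w, y') ∈ piece M c κ ρ J} = extendZero J ⁻¹'
      Set.Icc (fun i => if i ∈ J then 0 else (M *ᵥ u) i - radius c κ ρ J)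
        (fun i => if i ∈ J then 0 else (M *ᵥ u) i + radius c κ ρ J) := by
  have hr := hM.le_radius hρ hJ
  ext y'
  rw [Set.mem_preimage, mem_Icc_box, Set.mem_ofPred_eq]
  have hu0' : ∀ j ∈ J, (merge J (w, y') - M *ᵥ u) j = 0 := fun j hj => by
    have := hu0 j hj
    rw [Pi.sub_apply, merge_of_mem _ _ hj] at this ⊢
    exact this
  constructor
  · intro h
    obtain ⟨v, hv, hv1, hv0⟩ := mem_tube_of_mem_piece h
    have huv : u = v := hM.eq_of_lift hJ hu hv fun j hj => by
      have h1 := hu0' j hj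
      have h2 := hv0 j hj
      rw [Pi.sub_apply, sub_eq_zero] at h1 h2
      rw [← h1, h2]
    subst huv
    refine ⟨fun i hi => by simp [extendZero, hi], fun i hi => ?_⟩
    have := hv1 i
    rw [Pi.sub_apply, merge_of_notMem _ _ hi] at this
    simpa [extendZero, hi] using this
  · rintro ⟨-, h⟩
    have heq : merge J (w, y) + extendZero J (y' - y) = merge J (w, y') := by
      rw [merge_eq_add w y, merge_eq_add w y', add_assoc]
      congr 1
      funext i
      by_cases hi : i ∈ J <;> simp [extendZero, hi]
    rw [← heq]
    refine hM.add_mem_piece hρ hq hJ hx (fun j hj => by simp [extendZero, hj]) ?_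
    rw [heq]
    refine ⟨u, hu, mem_cubeSlice_of (by linarith) hu0' fun i hi => ?_⟩
    have := h i hi
    rw [Pi.sub_apply, merge_of_notMem _ _ hi]
    simpa [extendZero, hi] using this

lemma norm_setIntegral_piece_le {s ℓ : ℝ} {H : (Fin n → ℝ) → ℂ} {Babs : Set (Fin n → ℝ)}
    (hs : κ * s ≤ c * ρ / 36) (hq : q * (4 * ρ) ≤ 1) (hJ : J.card * κ ≤ c / 12) (hℓ : 0 ≤ ℓ)
    (hsmall : ∀ x ∈ cell M, x ∉ Babs → ∑ j, (if ρ / 3 < |x j| then |x j| else 0) ≤ s)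
    (hA : NullMeasurableSet {x | ∃ g : latticeSubgroup M, (g : Fin n → ℝ) + x ∈ Babs})
    (hH : IntegrableOn H (piece M c κ ρ J))
    (hyp : ∀ a b : Fin n → ℝ,
      cubeSlice J (ρ / 3) ⊆ Set.Icc a b →
      Set.Icc a b ⊆ cubeSlice J (4 / 3 * ρ) →
      ∀ w ∈ (cell M + cube n (ρ / 3)) ∩
          (Submodule.span ℝ ((fun j => Pi.single j (1 : ℝ)) '' (J : Set (Fin n))) :
            Set (Fin n → ℝ)),
        (∀ j ∈ J, ρ * M j j / (9 * ⨆ i, M i i) < |w j|) →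
        (reduceSet M ({w} + cubeSlice J (2 * ρ)) ∩ (cell M \ Babs)).Nonempty →
        ‖sliceIntegral J (Set.Icc a b) H w‖ ≤ ℓ) :
    ‖∫ x in piece M c κ ρ J, H x‖ ≤
      (∫ x in piece M c κ ρ J,
        {x | ∃ g : latticeSubgroup M, (g : Fin n → ℝ) + x ∈ Babs}.indicator (fun x => ‖H x‖) x) +
        inftyNorm M ^ J.card * ℓ := by
  have hqρ : q * (2 * ρ) < 1 := by linarith
  have hc := hM.c_pos
  refine norm_setIntegral_le_of_slices (hM.measurableSet_piece hJ) hA hH (inftyNorm_nonneg M) hℓ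
    ?_ ?_
  · rintro x ⟨⟨u, -, hu1, -, hu0⟩, -⟩ j hj
    have h1 := hu0 j hj
    rw [Pi.sub_apply, sub_eq_zero] at h1
    rw [h1]
    refine (abs_mulVec_le_inftyNorm (r := 1 / 2) (by norm_num) (fun i => ?_) j).trans_eq (by ring)
    exact abs_le.2 ⟨by linarith [(hu1 i).1], (hu1 i).2⟩
  · intro w y hx hxA
    obtain ⟨⟨u, hu, hu1, hur, hu0⟩, -⟩ := id hx
    obtain ⟨⟨g, k, rfl⟩, hg, -⟩ := existsUnique_add_mem_cell hM.isUnit_det (merge J (w, y))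
    have hgB : M *ᵥ intVec k + merge J (w, y) ∉ Babs := fun h => hxA ⟨⟨_, k, rfl⟩, h⟩
    change M *ᵥ intVec k + merge J (w, y) ∈ cell M at hg
    have hus : ∑ j ∈ J, |u j| ≤ 2 / c * s := by
      refine hM.sum_abs_le_of_mem_piece hρ hs hq hJ hx hu hu1 hu0 (k := k) ?_ ?_
      · rwa [add_comm]
      · rw [add_comm]
        exact hsmall _ hg hgB
    have hr := hM.le_radius hρ hJ
    have hr' := hM.radius_le hρ (J := J)
    -- The centre moves by at most `ρ/18` and the half-width lies in `[2ρ/3, ρ]`, so the box lies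
    -- between the cubes of half-widths `ρ/3` and `4ρ/3`.
    have hshift : ∀ i, i ∉ J → |(M *ᵥ u) i| ≤ ρ / 18 := fun i hi => by
      calc |(M *ᵥ u) i| ≤ κ * ∑ j ∈ J, |u j| := hM.abs_mulVec_le hu hi
        _ ≤ κ * (2 / c * s) := mul_le_mul_of_nonneg_left hus hM.κ_nonneg
        _ = 2 / c * (κ * s) := by ring
        _ ≤ 2 / c * (c * ρ / 36) := mul_le_mul_of_nonneg_left hs (by positivity)
        _ = ρ / 18 := by field_simp; norm_num
    have hbox := hM.preimage_piece_eq_box hρ hqρ hJ hx hu hu0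
    rw [hbox]
    have hmerge : (fun y' => H (merge J (w, y'))) =
        fun y' => H (merge J (w, 0) + extendZero J y') := funext fun y' => by rw [merge_eq_add]
    rw [hmerge]
    have hsub : Set.Icc (fun i => if i ∈ J then 0 else (M *ᵥ u) i - radius c κ ρ J)
        (fun i => if i ∈ J then 0 else (M *ᵥ u) i + radius c κ ρ J) ⊆
        cubeSlice J (4 / 3 * ρ) := by
      intro z hz
      rw [mem_Icc_box] at hz
      refine mem_cubeSlice_of (by positivity) hz.1 fun i hi => ?_
      have h1 := hz.2 i hi
      have h2 := hshift i hi
      have h3 := abs_sub_abs_le_abs_sub (z i) ((M *ᵥ u) i)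
      linarith
    refine hyp _ _ ?_ hsub (merge J (w, 0)) ⟨?_, merge_zero_mem_span w⟩ ?_ ?_
    · intro z hz
      rw [mem_Icc_box]
      refine ⟨hz.2, fun i hi => ?_⟩
      have h1 := hz.1 i
      have h2 := hshift i hi
      have h3 := abs_sub (z i) ((M *ᵥ u) i)
      linarith
    -- The cell point `M u` agrees with `w` on `J` and is at most `ρ/18` off `J`.
    · refine Set.mem_add.2 ⟨M *ᵥ u, ⟨u, hu1, rfl⟩, merge J (w, 0) - M *ᵥ u, fun i => ?_, by abel⟩
      by_cases hi : i ∈ J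
      · have h1 := hu0 i hi
        rw [Pi.sub_apply, merge_of_mem _ _ hi] at h1 ⊢
        rw [h1, abs_zero]; positivity
      · rw [Pi.sub_apply, merge_zero_of_notMem _ hi, zero_sub, abs_neg]
        linarith [hshift i hi]
    · intro j hj
      have h1 := hM.lt_abs_of_mem_piece hρ hs hJ hx hu hu0 hus hj
      rw [merge_of_mem _ _ hj] at h1 ⊢
      refine lt_of_le_of_lt ?_ h1
      have h2 : M j j ≤ ⨆ i, M i i := le_ciSup (f := fun i => M i i) (Set.finite_range _).bddAbove j
      have h3 : 0 < ⨆ i, M i i := (hc.trans_le (hM.diag j)).trans_le h2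
      rw [div_le_div_iff₀ (by positivity) (by norm_num)]
      nlinarith [mul_le_mul_of_nonneg_left h2 hρ.le]
    · refine ⟨M *ᵥ intVec k + merge J (w, y), ⟨hg, merge J (w, y), ?_, -k, ?_⟩, hg, hgB⟩
      · rw [merge_eq_add w y]
        refine Set.add_mem_add rfl ?_
        have hy : extendZero J y ∈ cubeSlice J (4 / 3 * ρ) := by
          refine hsub ?_
          have : y ∈ {y' | merge J (w, y') ∈ piece M c κ ρ J} := hx
          rw [hbox] at this
          exact this
        exact ⟨fun i => (hy.1 i).trans (by linarith), hy.2⟩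
      · change _ = M *ᵥ intVec (-k)
        rw [intVec_neg, Matrix.mulVec_neg]
        abel

end Dominant

/-! ### Counting index sets and assembling the bound -/

lemma sum_card_pow_mul_le {R : ℝ} (hR : 0 ≤ R) {L : ℕ → ℝ} (hL : ∀ j ∈ Finset.Icc 1 n, 0 ≤ L j)
    (s : Finset (Finset (Fin n))) (hs : ∅ ∉ s) :
    ∑ J ∈ s, R ^ J.card * L J.card ≤ ∑ j ∈ Finset.Icc 1 n, ((n : ℝ) * R) ^ j * L j := by
  -- The value at `0` is suppressed because `L 0` may be negative.
  let f : ℕ → ℝ := fun j => if j = 0 then 0 else R ^ j * L j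
  have hf0 : ∀ j ≤ n, 0 ≤ f j := fun j hj => by
    by_cases h : j = 0
    · simp [f, h]
    · simp only [f, h, if_false]
      exact mul_nonneg (pow_nonneg hR _)
        (hL j (Finset.mem_Icc.2 ⟨Nat.one_le_iff_ne_zero.2 h, hj⟩))
  have hcard : ∀ J : Finset (Fin n), J.card ≤ n := fun J => by simpa using Finset.card_le_univ J
  have h1 : ∑ J ∈ s, R ^ J.card * L J.card = ∑ J ∈ s, f J.card := by
    refine Finset.sum_congr rfl fun J hJ => ?_
    have : J.card ≠ 0 := fun h => hs (Finset.card_eq_zero.1 h ▸ hJ)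
    simp [f, this]
  have h2 : ∑ J ∈ s, f J.card ≤ ∑ J ∈ (Finset.univ : Finset (Fin n)).powerset, f J.card :=
    Finset.sum_le_sum_of_subset_of_nonneg (fun J _ => by simp) fun J _ _ => hf0 _ (hcard J)
  have h3 : Finset.Icc 1 n ⊆ Finset.range (n + 1) := fun j hj => by
    rw [Finset.mem_Icc] at hj
    rw [Finset.mem_range]
    omega
  rw [h1]
  refine h2.trans ?_
  rw [Finset.sum_powerset_apply_card f, Finset.card_univ, Fintype.card_fin,
    ← Finset.sum_subset h3]
  · refine Finset.sum_le_sum fun j hj => ?_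
    obtain ⟨hj1, hjn⟩ := Finset.mem_Icc.1 hj
    have h4 : ((n.choose j : ℕ) : ℝ) ≤ (n : ℝ) ^ j := by exact_mod_cast Nat.choose_le_pow n j
    have h5 : f j = R ^ j * L j := if_neg (by omega)
    rw [nsmul_eq_mul, mul_pow, mul_assoc, ← h5]
    exact mul_le_mul_of_nonneg_right h4 (hf0 j hjn)
  · intro j hj hj'
    have : j = 0 := by
      by_contra h
      exact hj' (Finset.mem_Icc.2 ⟨Nat.one_le_iff_ne_zero.2 h, Nat.lt_succ_iff.1
        (Finset.mem_range.1 hj)⟩)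
    simp [this, f]

lemma AffinelyMeasurable.nullMeasurableSet {S : Set (Fin n → ℝ)} (hS : AffinelyMeasurable S) :
    NullMeasurableSet S :=
  hS n (AffineMap.id ℝ _) Function.injective_id

end PeriodicBoxing

open PeriodicBoxing in
theorem theoremB1 (c C K : ℝ) (hc : 0 < c) :
    ∃ ε : ℝ, 0 < ε ∧
      ∀ (n : ℕ) (_ : 1 ≤ n) (M : Matrix (Fin n) (Fin n) ℝ)
        (_ : PeriodicBoxing.NearDiagonal c C K M)
        (ζ ρ : ℝ) (_ : 0 < ζ) (_ : ζ ≤ ε) (_ : 0 < ρ) (_ : ρ ≤ ε)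
        (H : (Fin n → ℝ) → ℂ)
        (_ : IntegrableOn H (PeriodicBoxing.cell M) volume)
        (_ : ∀ x, ∀ ξ ∈ PeriodicBoxing.lattice M, H (x + ξ) = H x)
        (Babs : Set (Fin n → ℝ))
        (_ : PeriodicBoxing.largeRegion M ζ ρ ⊆ Babs)
        (_ : Babs ⊆ PeriodicBoxing.cell M)
        (_ : PeriodicBoxing.AffinelyMeasurable Babs)
        (L : ℕ → ℝ)
        (_ : ∀ j ∈ Finset.Icc 1 n, 0 ≤ L j)
        (_ : ∀ J : Finset (Fin n), J.Nonempty →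
          ∀ a b : Fin n → ℝ,
            PeriodicBoxing.cubeSlice J (ρ / 3) ⊆ Set.Icc a b →
            Set.Icc a b ⊆ PeriodicBoxing.cubeSlice J (4 / 3 * ρ) →
          ∀ w ∈ (PeriodicBoxing.cell M + PeriodicBoxing.cube n (ρ / 3)) ∩
              (Submodule.span ℝ ((fun j => Pi.single j (1 : ℝ)) '' (J : Set (Fin n))) :
                Set (Fin n → ℝ)),
            (∀ j ∈ J, ρ * M j j / (9 * ⨆ i, M i i) < |w j|) →
            (PeriodicBoxing.reduceSet M ({w} + PeriodicBoxing.cubeSlice J (2 * ρ)) ∩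
              (PeriodicBoxing.cell M \ Babs)).Nonempty →
            ‖PeriodicBoxing.sliceIntegral J (Set.Icc a b) H w‖ ≤ L J.card),
        ‖∫ x in PeriodicBoxing.cell M \ PeriodicBoxing.cube n ρ, H x‖ ≤
          (∫ x in Babs, ‖H x‖) +
            ∑ j ∈ Finset.Icc 1 n, ((n : ℝ) * PeriodicBoxing.inftyNorm M) ^ j * L j := by
  classical
  -- The first bound gives `|K| ζ ≤ c / 12`, hence `κ s ≤ c ρ / 36` for `s = ζ n ρ / 3`; the second
  -- gives `4qρ ≤ 1`.
  refine ⟨min (c / (12 * (|K| + 1))) (1 / (4 * (|C| + |K| + 1))), by positivity, ?_⟩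
  intro n hn M hND ζ ρ hζ hζε hρ hρε H hHi hHp Babs hB1 hB2 hB3 L hL hyp
  have hn0 : (0 : ℝ) < n := Nat.cast_pos.2 hn
  have hM := hND.dominant hc
  set κ := |K| / n with hκ
  set q := |C| + |K| with hq
  have hq0 : 0 ≤ q := hM.q_nonneg
  have hqρ : q * (4 * ρ) ≤ 1 := by
    have h1 : ρ ≤ 1 / (4 * (q + 1)) := hρε.trans (min_le_right _ _)
    rw [le_div_iff₀ (by positivity)] at h1
    nlinarith
  have hqρ2 : q * (2 * ρ) < 1 := by linarith
  have hs : κ * ((1 / 3) * ζ * n * ρ) ≤ c * ρ / 36 := by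
    have h1 : ζ ≤ c / (12 * (|K| + 1)) := hζε.trans (min_le_left _ _)
    rw [le_div_iff₀ (by positivity)] at h1
    have h2 : κ * ((1 / 3) * ζ * n * ρ) = |K| * ζ / 3 * ρ := by
      rw [hκ]; field_simp
    have h3 : |K| * ζ / 3 ≤ c / 36 := by nlinarith
    rw [h2]
    calc |K| * ζ / 3 * ρ ≤ c / 36 * ρ := mul_le_mul_of_nonneg_right h3 hρ.le
      _ = c * ρ / 36 := by ring
  have hsmall : ∀ x ∈ cell M, x ∉ Babs →
      ∑ j, (if ρ / 3 < |x j| then |x j| else 0) ≤ (1 / 3) * ζ * n * ρ := fun x hx hxB => by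
    by_contra! h
    exact hxB (hB1 ⟨hx, h⟩)
  let G := latticeSubgroup M
  let F : Finset (Finset (Fin n)) := Finset.univ.filter fun J => (J.card : ℝ) * κ ≤ c / 12
  have hF : ∀ J ∈ F, (J.card : ℝ) * κ ≤ c / 12 := fun J hJ => (Finset.mem_filter.1 hJ).2
  have hF0 : ∅ ∈ F := Finset.mem_filter.2 ⟨Finset.mem_univ _, by simpa using by positivity⟩
  have hD := measurableSet_cell (M := M) hM.isUnit_det
  have hD1 := existsUnique_add_mem_cell (M := M) hM.isUnit_det
  have hT : ∀ J ∈ F, MeasurableSet (piece M c κ ρ J) := fun J hJ => hM.measurableSet_piece (hF J hJ)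
  have hdis : ∀ I ∈ F, ∀ J ∈ F, ∀ x ∈ piece M c κ ρ I, ∀ g : G,
      (g : Fin n → ℝ) + x ∈ piece M c κ ρ J → I = J ∧ g = 0 := by
    rintro I hI J hJ x hx ⟨_, k, rfl⟩ hg
    obtain ⟨h1, h2⟩ := hM.eq_of_mem_piece hρ hqρ2 (hF I hI) (hF J hJ) (k := k) hx
      (by rw [add_comm]; exact hg)
    refine ⟨h1, Subtype.ext ?_⟩
    change M *ᵥ intVec k = 0
    rw [h2, intVec_zero, Matrix.mulVec_zero]
  have hrest : cell M ∩ unmet G F (piece M c κ ρ) ⊆ Babs := by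
    rintro x ⟨hx, hx'⟩
    by_contra hxB
    obtain ⟨hJ, h1⟩ := hM.mem_tube_large hρ hs (hsmall x hx hxB)
    obtain ⟨I, hI, k, hk⟩ := Dominant.exists_mem_piece h1
    refine hx' ⟨_, k, rfl⟩ I (Finset.mem_filter.2 ⟨Finset.mem_univ _,
      hM.card_mul_le_of_subset hI hJ⟩) ?_
    rw [add_comm] at hk
    exact hk
  -- Pieces may leave the cell, so `Babs` is periodised; its indicator times `‖H‖` then decomposes
  -- over the same fundamental domain as `H`.
  let A : Set (Fin n → ℝ) := {x | ∃ g : G, (g : Fin n → ℝ) + x ∈ Babs}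
  have hBA : Babs ⊆ A := fun x hx => ⟨0, by simpa using hx⟩
  have hAB : cell M ∩ A = Babs := by
    refine Set.Subset.antisymm ?_ fun x hx => ⟨hB2 hx, hBA hx⟩
    rintro x ⟨hx, g, hg⟩
    have : g = 0 := (hD1 x).unique (hB2 hg) (by simpa using hx)
    simpa [this] using hg
  have hA : NullMeasurableSet A := by
    have : A = ⋃ g : G, (fun x => (g : Fin n → ℝ) + x) ⁻¹' Babs := by ext x; simp [A]
    rw [this]
    exact NullMeasurableSet.iUnion fun g => hB3.nullMeasurableSet.preimage
      (measurePreserving_add_left volume _).quasiMeasurePreserving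
  have hHp' : ∀ (g : G) (x : Fin n → ℝ), H ((g : Fin n → ℝ) + x) = H x := fun g x => by
    rw [add_comm]; exact hHp x g g.2
  have hfp : ∀ (g : G) (x : Fin n → ℝ),
      A.indicator (fun x => ‖H x‖) ((g : Fin n → ℝ) + x) = A.indicator (fun x => ‖H x‖) x := by
    intro g x
    have : (g : Fin n → ℝ) + x ∈ A ↔ x ∈ A := by
      constructor
      · rintro ⟨h, hh⟩
        exact ⟨h + g, by rwa [AddSubgroup.coe_add, add_assoc]⟩
      · rintro ⟨h, hh⟩
        exact ⟨h - g, by rwa [AddSubgroup.coe_sub, ← add_assoc, sub_add_cancel]⟩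
    by_cases hx : x ∈ A
    · rw [Set.indicator_of_mem hx, Set.indicator_of_mem (this.2 hx), hHp']
    · rw [Set.indicator_of_notMem hx, Set.indicator_of_notMem (fun h => hx (this.1 h))]
  have hfi : IntegrableOn (A.indicator fun x => ‖H x‖) (cell M) :=
    hHi.norm.indicator₀ (hA.mono_ac Measure.restrict_le_self.absolutelyContinuous)
  obtain ⟨hHT, hHsum⟩ := setIntegral_eq_sum_add hD hD1 hT hdis hHp' hHi
  obtain ⟨-, hfsum⟩ := setIntegral_eq_sum_add hD hD1 hT hdis hfp hfi
  have hBint : ∫ x in cell M, A.indicator (fun x => ‖H x‖) x = ∫ x in Babs, ‖H x‖ := by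
    rw [← integral_indicator hD, Set.indicator_indicator, hAB,
      integral_indicator₀ hB3.nullMeasurableSet]
  have hrestint : ∫ x in cell M ∩ unmet G F (piece M c κ ρ), A.indicator (fun x => ‖H x‖) x =
      ∫ x in cell M ∩ unmet G F (piece M c κ ρ), ‖H x‖ :=
    setIntegral_congr_fun (hD.inter (measurableSet_unmet hT)) fun x hx =>
      Set.indicator_of_mem (hBA (hrest hx)) _
  have hcube : cube n ρ ⊆ cell M := fun x hx => by
    refine ⟨M⁻¹ *ᵥ x, fun j => ?_, ?_⟩
    · have h1 := abs_le.1 (hM.inv_bound x ρ hx j)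
      constructor <;> linarith
    · rw [Matrix.mulVec_mulVec, Matrix.mul_nonsing_inv M hM.isUnit_det, Matrix.one_mulVec]
  have hcubem : MeasurableSet (cube n ρ) := by
    rw [← piece_empty (M := M) (c := c) (κ := κ)]; exact hT ∅ hF0
  have hmain : ∫ x in cell M \ cube n ρ, H x = (∑ J ∈ F.erase ∅, ∫ x in piece M c κ ρ J, H x) +
      ∫ x in cell M ∩ unmet G F (piece M c κ ρ), H x := by
    rw [setIntegral_sdiff hcubem hHi hcube, hHsum, ← Finset.add_sum_erase F _ hF0, piece_empty]
    ring
  have hpiece : ∀ J ∈ F.erase ∅, ‖∫ x in piece M c κ ρ J, H x‖ ≤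
      (∫ x in piece M c κ ρ J, A.indicator (fun x => ‖H x‖) x) +
        inftyNorm M ^ J.card * L J.card := fun J hJ => by
    obtain ⟨hJ0, hJF⟩ := Finset.mem_erase.1 hJ
    have hJne := Finset.nonempty_iff_ne_empty.2 hJ0
    have hcard : J.card ≤ n := by simpa using Finset.card_le_univ J
    exact hM.norm_setIntegral_piece_le hρ hs hqρ (hF J hJF)
      (hL _ (Finset.mem_Icc.2 ⟨Finset.card_pos.2 hJne, hcard⟩)) hsmall hA (hHT J hJF) (hyp J hJne)
  have hnonneg : 0 ≤ ∫ x in piece M c κ ρ ∅, A.indicator (fun x => ‖H x‖) x :=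
    integral_nonneg fun x => Set.indicator_nonneg (fun _ _ => norm_nonneg _) _
  have hLsum := sum_card_pow_mul_le (inftyNorm_nonneg M) hL (F.erase ∅) (Finset.notMem_erase _ _)
  have h1 : ‖∑ J ∈ F.erase ∅, ∫ x in piece M c κ ρ J, H x‖ ≤
      (∑ J ∈ F.erase ∅, ∫ x in piece M c κ ρ J, A.indicator (fun x => ‖H x‖) x) +
        ∑ J ∈ F.erase ∅, inftyNorm M ^ J.card * L J.card := by
    rw [← Finset.sum_add_distrib]
    exact (norm_sum_le _ _).trans (Finset.sum_le_sum hpiece)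
  have h2 := norm_integral_le_integral_norm (μ := volume.restrict
    (cell M ∩ unmet G F (piece M c κ ρ))) H
  -- The charges on all pieces and on the remainder add up to the integral of `‖H‖` over `Babs`; the
  -- charge on the cube is nonnegative and is discarded.
  rw [← hBint, hfsum, hrestint, ← Finset.add_sum_erase F _ hF0, hmain]
  refine (norm_add_le _ _).trans ?_
  linarith
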